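/- Let $k$ be a field. All rings are associative and unital, "noetherian" means left and right noetherian, modules are left modules, and ideals are two-sided. An $\mathbb{N}$-graded $k$-algebra $A=\bigoplus_{i\ge 0}A_i$ is *connected graded* if $A_0=k$; then $k$ is regarded as the $A$-module $A/A_{\ge 1}$. A connected graded $k$-algebra $A$ is *AS-regular of dimension $d$* if $\operatorname{gldim}(A)=d<\infty$, $\operatorname{Ext}^i_A(k,A)=0$ for all $i\neq d$, and $\operatorname{Ext}^d_A(k,A)\cong k$. A proper ideal $P$ of a ring $A$ is *prime* if $aAb\subseteq P$ implies $a\in P$ or $b\in P$, for all $a,b\in A$; $A$ is a *prime ring* if $0$ is a prime ideal. An element $a\in A$ is *normal* if $Aa=aA$, and an ideal is *principal* if it is generated by a normal element. A *noetherian unique factorization ring* (noetherian UFR) is a noetherian prime ring in which every nonzero prime ideal contains a nonzero principal prime ideal. **Proposition.** Every noetherian AS-regular $k$-algebra of dimension $2$ is a noetherian UFR. -/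

import Mathlib

universe u v

namespace NCRing

/-- A ring that is both left and right noetherian. -/
def IsTwoSidedNoetherian (A : Type v) [Ring A] : Prop :=
  IsNoetherianRing A ∧ IsNoetherianRing Aᵐᵒᵖ

/-- A (noncommutative) prime ideal: a proper two-sided ideal `P` such that
`a A b ⊆ P` implies `a ∈ P` or `b ∈ P`. -/
def IsPrimeIdeal {A : Type v} [Ring A] (P : TwoSidedIdeal A) : Prop :=
  P ≠ ⊤ ∧ ∀ a b : A, (∀ r : A, a * r * b ∈ P) → a ∈ P ∨ b ∈ P

/-- A prime ring: the zero ideal is a prime ideal. -/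
def IsPrimeRing (A : Type v) [Ring A] : Prop :=
  IsPrimeIdeal (⊥ : TwoSidedIdeal A)

/-- A normal element: `A a = a A`. -/
def IsNormalElement {A : Type v} [Ring A] (a : A) : Prop :=
  Set.range (fun r : A => r * a) = Set.range (fun r : A => a * r)

/-- A principal ideal: a two-sided ideal generated by a normal element. -/
def IsPrincipalIdeal {A : Type v} [Ring A] (I : TwoSidedIdeal A) : Prop :=
  ∃ a : A, IsNormalElement a ∧ I = TwoSidedIdeal.span {a}

/-- A noetherian unique factorization ring: a noetherian prime ring in which every nonzero
prime ideal contains a nonzero principal prime ideal. -/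
def IsNoetherianUFR (A : Type v) [Ring A] : Prop :=
  IsTwoSidedNoetherian A ∧ IsPrimeRing A ∧
    ∀ P : TwoSidedIdeal A, IsPrimeIdeal P → P ≠ ⊥ →
      ∃ Q : TwoSidedIdeal A, IsPrimeIdeal Q ∧ Q ≠ ⊥ ∧ IsPrincipalIdeal Q ∧ Q ≤ P

/-- The (left) global dimension: the supremum of the projective dimensions of all left modules. -/
noncomputable def globalDimension (A : Type v) [Ring A] : WithBot ℕ∞ :=
  ⨆ M : ModuleCat.{v} A, CategoryTheory.projectiveDimension M

section Graded

variable {k : Type u} [Field k] {A : Type v} [Ring A] [Algebra k A]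
variable (𝒜 : ℕ → Submodule k A) [GradedAlgebra 𝒜]

/-- The `ℕ`-graded algebra `A` is connected: the structure map `k → A` is a bijection of `k`
onto the degree-zero component. -/
def IsConnectedGraded : Prop :=
  Function.Injective (algebraMap k A) ∧ ∀ a : A, a ∈ 𝒜 0 ↔ ∃ c : k, algebraMap k A c = a

/-- The trivial left module `A / A_{≥ 1}` of a graded algebra; it is `k` when `A` is connected. -/
def trivialModule : ModuleCat.{v} A :=
  ModuleCat.of A (A ⧸ (HomogeneousIdeal.irrelevant 𝒜).toIdeal)

/-- The graded algebra `A` is Artin-Schelter regular of dimension `d`: it is connected graded, has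
global dimension `d`, `Ext^i_A(k, A) = 0` for `i ≠ d`, and `Ext^d_A(k, A) ≅ k`. -/
structure IsASRegular (d : ℕ) : Prop where
  connected : IsConnectedGraded 𝒜
  globalDimension_eq : globalDimension A = (d : WithBot ℕ∞)
  ext_eq_zero : ∀ i : ℕ, i ≠ d →
    Subsingleton (CategoryTheory.Abelian.Ext (trivialModule 𝒜) (ModuleCat.of A A) i)
  ext_iso : Nonempty
    (CategoryTheory.Abelian.Ext (trivialModule 𝒜) (ModuleCat.of A A) d ≃ₗ[k] k)

end Graded

end NCRing

namespace NCRing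

open DirectSum

/-! ### Homogeneous components and order of vanishing. -/

section Components

variable {k : Type u} [Field k] {A : Type v} [Ring A] [Algebra k A]
variable (𝒜 : ℕ → Submodule k A) [GradedAlgebra 𝒜]

/-! Regularity in dimension 2 means that the minimal graded resolution of `k` is `0 → A → Aⁿ → A → k
→ 0`, with maps given by homogeneous families `y` and `x`, and that its `A`-dual resolves the
trivial right module (`exists_isKoszul`). This left-right symmetric package, `IsKoszul`, is nearly
all that is used afterwards.

Call a left ideal `I` saturated if `x i * a ∈ I` for all `i` forces `a ∈ I`, that is, if `A ⧸ I` has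
no nonzero element killed by `A_{≥1}`. By duality and a Nakayama argument, saturated graded left
ideals are free (`IsKoszul.exists_free_generators`), and by the rank condition they are principal
(`IsKoszul.exists_generator`). Annihilators of homogeneous elements are saturated, which leads to
`A` being a domain (`IsKoszul.isDomain`). Comparing ranks then gives `n = 2`, and the single
relation `y 0 * x 0 + y 1 * x 1 = 0` yields a homogeneous normal element of positive degree
(`IsKoszul.exists_homogeneous_normal`).

Let `P` be a nonzero prime. If `P` contains all `x i`, it contains `A_{≥1}`, hence a homogeneous
normal element of least positive degree, which generates a prime (`IsKoszul.exists_prime_element`).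
Otherwise `P` is itself saturated. If it contains a nonzero homogeneous element, its largest graded
subideal is a nonzero saturated prime, hence principal
(`IsKoszul.exists_prime_element_of_homogeneous_mem`). If it contains none, `P` itself is principal
(`IsKoszul.exists_generator_of_no_homogeneous`): the leading forms of the elements of `P` of
shortest support form a saturated graded ideal, whose generator lifts to some `c ∈ P`. Every `p ∈ P`
lies in `A * c` after multiplication by a nonzero homogeneous `s`, and a noncommutative Gauss lemma
(`exists_mul_eq_of_primitive`) cancels `s`. -/

/-- The homogeneous component of degree `n`. -/
noncomputable def component (n : ℕ) : A →ₗ[k] A := GradedAlgebra.proj 𝒜 n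

theorem component_apply (n : ℕ) (a : A) : component 𝒜 n a = (decompose 𝒜 a n : A) := rfl

theorem component_mem (n : ℕ) (a : A) : component 𝒜 n a ∈ 𝒜 n := (decompose 𝒜 a n).2

variable {𝒜}

theorem component_same {n : ℕ} {a : A} (h : a ∈ 𝒜 n) : component 𝒜 n a = a :=
  decompose_of_mem_same 𝒜 h

theorem component_ne {n j : ℕ} {a : A} (h : a ∈ 𝒜 n) (hj : n ≠ j) : component 𝒜 j a = 0 :=
  decompose_of_mem_ne 𝒜 h hj

theorem mem_of_component {n : ℕ} {a : A} (h : component 𝒜 n a = a) : a ∈ 𝒜 n :=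
  h ▸ component_mem 𝒜 n a

theorem component_of_mem {n j : ℕ} {a : A} (h : a ∈ 𝒜 n) :
    component 𝒜 j a = if n = j then a else 0 := by
  split_ifs with hj
  · exact hj ▸ component_same h
  · exact component_ne h hj

theorem component_mul_right {d : ℕ} {b : A} (hb : b ∈ 𝒜 d) (n : ℕ) (a : A) :
    component 𝒜 n (a * b) = if d ≤ n then component 𝒜 (n - d) a * b else 0 := by
  simp only [component_apply]
  exact coe_decompose_mul_of_right_mem 𝒜 n hb

theorem component_mul_left {d : ℕ} {b : A} (hb : b ∈ 𝒜 d) (n : ℕ) (a : A) :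
    component 𝒜 n (b * a) = if d ≤ n then b * component 𝒜 (n - d) a else 0 := by
  simp only [component_apply]
  exact coe_decompose_mul_of_left_mem 𝒜 n hb

theorem component_mul_right_add {d : ℕ} {b : A} (hb : b ∈ 𝒜 d) (n : ℕ) (a : A) :
    component 𝒜 (n + d) (a * b) = component 𝒜 n a * b := by
  simp [component_mul_right hb]

theorem component_mul_left_add {d : ℕ} {b : A} (hb : b ∈ 𝒜 d) (n : ℕ) (a : A) :
    component 𝒜 (d + n) (b * a) = b * component 𝒜 n a := by
  simp [component_mul_left hb]

variable (𝒜)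

theorem exists_component_bound (a : A) : ∃ N, ∀ n, N ≤ n → component 𝒜 n a = 0 := by
  classical
  refine ⟨(decompose 𝒜 a).support.sup id + 1, fun n hn => ?_⟩
  by_contra h
  have : n ∈ (decompose 𝒜 a).support := by
    rw [DFinsupp.mem_support_iff]
    intro h0
    exact h (by rw [component_apply, h0]; rfl)
  have := Finset.le_sup (f := id) this
  simp only [id] at this
  omega

variable {𝒜}

theorem eq_of_component_eq {a b : A} (h : ∀ n, component 𝒜 n a = component 𝒜 n b) : a = b := by
  apply (decompose 𝒜).injective
  ext n
  exact h n

theorem sum_component {a : A} {N : ℕ} (h : ∀ n, N ≤ n → component 𝒜 n a = 0) :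
    ∑ n ∈ Finset.range N, component 𝒜 n a = a := by
  apply eq_of_component_eq (𝒜 := 𝒜)
  intro j
  rw [map_sum]
  by_cases hj : j < N
  · rw [Finset.sum_eq_single j]
    · exact component_same (component_mem 𝒜 j a)
    · intro i _ hi
      exact component_ne (component_mem 𝒜 i a) hi
    · simp [hj]
  · rw [h j (by omega)]
    apply Finset.sum_eq_zero
    intro i hi
    rw [Finset.mem_range] at hi
    exact component_ne (component_mem 𝒜 i a) (by omega)

theorem exists_component_ne_zero {a : A} (h : a ≠ 0) : ∃ n, component 𝒜 n a ≠ 0 := by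
  by_contra! hc
  exact h (eq_of_component_eq (𝒜 := 𝒜) fun n => by rw [hc n, map_zero])

theorem component_component (n j : ℕ) (a : A) :
    component 𝒜 j (component 𝒜 n a) = if n = j then component 𝒜 n a else 0 :=
  component_of_mem (component_mem 𝒜 n a)

/-- Induction on homogeneous components. -/
theorem component_induction {p : A → Prop} (a : A) (h0 : p 0)
    (hadd : ∀ a b, p a → p b → p (a + b)) (h : ∀ n, p (component 𝒜 n a)) : p a := by
  obtain ⟨N, hN⟩ := exists_component_bound 𝒜 a
  rw [← sum_component hN]
  exact Finset.sum_induction _ p hadd h0 fun n _ => h n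

variable (𝒜)

/-- All components of degree less than `n` vanish. -/
def VanishesBelow (n : ℕ) (a : A) : Prop := ∀ j < n, component 𝒜 j a = 0

variable {𝒜}

theorem VanishesBelow.sum {ι : Type*} {s : Finset ι} {n : ℕ} {f : ι → A}
    (h : ∀ i ∈ s, VanishesBelow 𝒜 n (f i)) : VanishesBelow 𝒜 n (∑ i ∈ s, f i) := fun j hj => by
  rw [map_sum]
  exact Finset.sum_eq_zero fun i hi => h i hi j hj

theorem VanishesBelow.mul {p q : ℕ} {a b : A} (ha : VanishesBelow 𝒜 p a)
    (hb : VanishesBelow 𝒜 q b) : VanishesBelow 𝒜 (p + q) (a * b) := by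
  intro j hj
  refine component_induction (𝒜 := 𝒜) (p := fun b' => component 𝒜 j (a * b') = 0) b
    (by simp) (fun x y hx hy => by rw [mul_add, map_add, hx, hy, add_zero]) fun n => ?_
  rw [component_mul_right (component_mem 𝒜 n b)]
  split_ifs with hn
  · by_cases hq : n < q
    · rw [hb n hq, mul_zero]
    · rw [ha (j - n) (by omega), zero_mul]
  · rfl

theorem eq_zero_of_vanishesBelow {a : A} (h : ∀ n, VanishesBelow 𝒜 n a) : a = 0 :=
  eq_of_component_eq (𝒜 := 𝒜) fun n => by rw [h (n + 1) n (by omega), map_zero]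

theorem mem_irrelevant_iff_component {a : A} :
    a ∈ (HomogeneousIdeal.irrelevant 𝒜).toIdeal ↔ component 𝒜 0 a = 0 :=
  HomogeneousIdeal.mem_irrelevant_iff 𝒜 a

theorem vanishesBelow_one_iff {a : A} : VanishesBelow 𝒜 1 a ↔ component 𝒜 0 a = 0 :=
  ⟨fun h => h 0 one_pos, fun h j hj => by rwa [Nat.lt_one_iff.1 hj]⟩

theorem component_zero_mul (a b : A) :
    component 𝒜 0 (a * b) = component 𝒜 0 a * component 𝒜 0 b := by
  refine component_induction (𝒜 := 𝒜)
    (p := fun b' => component 𝒜 0 (a * b') = component 𝒜 0 a * component 𝒜 0 b') b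
    (by simp) (fun x y hx hy => by rw [mul_add, map_add, hx, hy, map_add, mul_add]) fun n => ?_
  rw [component_mul_right (component_mem 𝒜 n b), component_component]
  rcases Nat.eq_zero_or_pos n with rfl | hn
  · simp
  · rw [if_neg (by omega), if_neg (by omega), mul_zero]

end Components

/-! ### Graded modules and minimal homogeneous generators. -/

section Generators

variable {k : Type u} [Field k] {A : Type v} [Ring A] [Algebra k A]
variable (𝒜 : ℕ → Submodule k A) [GradedAlgebra 𝒜]

/-- Projections onto homogeneous components of a module over a graded ring. -/
structure GradedComponents (M : Type*) [AddCommGroup M] [Module A M] where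
  /-- The component of degree `n`. -/
  comp : ℕ → M →+ M
  comp_comp_self : ∀ n v, comp n (comp n v) = comp n v
  exists_sum_eq : ∀ v, ∃ N, ∑ n ∈ Finset.range N, comp n v = v
  comp_smul : ∀ e v, comp e v = v → ∀ a n,
    comp n (a • v) = if e ≤ n then component 𝒜 (n - e) a • v else 0

/-- A graded ring as a graded left module over itself. -/
noncomputable def GradedComponents.self : GradedComponents 𝒜 A where
  comp n := (component 𝒜 n).toAddMonoidHom
  comp_comp_self n v := component_same (component_mem 𝒜 n v)
  exists_sum_eq v := by
    obtain ⟨N, hN⟩ := exists_component_bound 𝒜 v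
    exact ⟨N, sum_component hN⟩
  comp_smul e v hv a n := component_mul_right (mem_of_component hv) n a

/-- The graded free module with generators in degrees `d i`. -/
noncomputable def GradedComponents.pi {ι : Type*} [Finite ι] (d : ι → ℕ) :
    GradedComponents 𝒜 (ι → A) where
  comp n :=
    { toFun := fun v i => if d i ≤ n then component 𝒜 (n - d i) (v i) else 0
      map_zero' := by ext i; simp
      map_add' := fun v w => by ext i; dsimp; split_ifs <;> simp }
  comp_comp_self n v := by
    ext i
    dsimp
    split_ifs
    · exact component_same (component_mem 𝒜 _ _)
    · rfl
  exists_sum_eq v := by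
    classical
    have := Fintype.ofFinite ι
    choose N hN using fun i => exists_component_bound 𝒜 (v i)
    refine ⟨(Finset.univ.sup fun i => N i + d i), ?_⟩
    ext i
    have h1 : N i + d i ≤ Finset.univ.sup fun i => N i + d i :=
      Finset.le_sup (f := fun i => N i + d i) (Finset.mem_univ i)
    set T := Finset.univ.sup fun i => N i + d i
    obtain ⟨t, ht⟩ : ∃ t, T = d i + t := ⟨T - d i, by omega⟩
    rw [Finset.sum_apply, ht, Finset.sum_range_add]
    have h2 : ∀ n, t ≤ n → component 𝒜 n (v i) = 0 := fun n hn => hN i n (by omega)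
    rw [Finset.sum_eq_zero, zero_add]
    · simpa using sum_component h2
    · intro x hx
      rw [Finset.mem_range] at hx
      simp [Nat.not_le.2 hx]
  comp_smul e v hv a n := by
    ext i
    have hvi : (if d i ≤ e then component 𝒜 (e - d i) (v i) else 0) = v i := congrFun hv i
    simp only [AddMonoidHom.coe_mk, ZeroHom.coe_mk, Pi.smul_apply, smul_eq_mul]
    by_cases h : d i ≤ e
    · rw [if_pos h] at hvi
      rw [component_mul_right (mem_of_component hvi)]
      split_ifs with h1 h2 h3 h4 h5
      · rw [Pi.smul_apply, smul_eq_mul]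
        congr 3
        omega
      · omega
      · omega
      · rfl
      · omega
      · rfl
    · rw [if_neg h] at hvi
      rw [← hvi]
      split_ifs <;> simp [← hvi]

variable {𝒜}

/-- A finitely generated graded submodule over a connected graded algebra has a finite
homogeneous generating family all of whose relations have coefficients in the irrelevant ideal. -/
theorem exists_minimal_generators (hconn : IsConnectedGraded 𝒜) {M : Type*} [AddCommGroup M]
    [Module A M] (C : GradedComponents 𝒜 M) (N : Submodule A M)
    (hN : ∀ n, ∀ v ∈ N, C.comp n v ∈ N) (hfg : N.FG) :
    ∃ (p : ℕ) (z : Fin p → M) (e : Fin p → ℕ), (∀ i, C.comp (e i) (z i) = z i) ∧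
      Submodule.span A (Set.range z) = N ∧
      ∀ a : Fin p → A, ∑ i, a i • z i = 0 → ∀ i, component 𝒜 0 (a i) = 0 := by
  classical
  have hex : ∃ p : ℕ, ∃ (z : Fin p → M) (e : Fin p → ℕ), (∀ i, C.comp (e i) (z i) = z i) ∧
      Submodule.span A (Set.range z) = N := by
    obtain ⟨S, hS⟩ := hfg
    choose B hB using C.exists_sum_eq
    let T : Finset (Σ _ : M, ℕ) := S.sigma fun v => Finset.range (B v)
    refine ⟨T.card, fun i => C.comp (T.equivFin.symm i).1.2 (T.equivFin.symm i).1.1,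
      fun i => (T.equivFin.symm i).1.2, fun i => C.comp_comp_self _ _, le_antisymm ?_ ?_⟩
    · rw [Submodule.span_le]
      rintro _ ⟨i, rfl⟩
      refine hN _ _ ?_
      rw [← hS]
      apply Submodule.subset_span
      exact (Finset.mem_sigma.1 (T.equivFin.symm i).2).1
    · rw [← hS, Submodule.span_le]
      intro v hv
      rw [SetLike.mem_coe, ← hB v]
      refine Submodule.sum_mem _ fun n hn => Submodule.subset_span ?_
      refine ⟨T.equivFin ⟨⟨v, n⟩, Finset.mem_sigma.2 ⟨hv, hn⟩⟩, ?_⟩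
      simp
  -- Take the least number of homogeneous generators. A relation with a nonzero constant coefficient
  -- at `i` has a degree `e i` part that expresses `z i` through the others, so `z i` could be
  -- dropped.
  obtain ⟨z, e, hz, hspan⟩ := Nat.find_spec hex
  refine ⟨Nat.find hex, z, e, hz, hspan, fun a ha i => ?_⟩
  by_contra hne
  obtain ⟨c, hc⟩ := (hconn.2 _).1 (component_mem 𝒜 0 (a i))
  have hc0 : c ≠ 0 := by rintro rfl; exact hne (by rw [← hc, map_zero])
  have key : ∑ j, (if e j ≤ e i then component 𝒜 (e i - e j) (a j) • z j else 0) = 0 := by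
    have h0 := congrArg (C.comp (e i)) ha
    rw [map_zero, map_sum] at h0
    exact (Finset.sum_congr rfl fun j _ => (C.comp_smul _ _ (hz j) _ _).symm).trans h0
  rw [← Finset.add_sum_erase _ _ (Finset.mem_univ i), if_pos le_rfl, Nat.sub_self, ← hc] at key
  have hzi : z i ∈ Submodule.span A (z '' {j | j ≠ i}) := by
    have h1 : algebraMap k A c • z i ∈ Submodule.span A (z '' {j | j ≠ i}) := by
      rw [eq_neg_of_add_eq_zero_left key]
      refine Submodule.neg_mem _ (Submodule.sum_mem _ fun j hj => ?_)
      split_ifs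
      · exact Submodule.smul_mem _ _ (Submodule.subset_span ⟨j, (Finset.mem_erase.1 hj).1, rfl⟩)
      · exact Submodule.zero_mem _
    have h2 := Submodule.smul_mem _ (algebraMap k A c⁻¹) h1
    rwa [smul_smul, ← map_mul, inv_mul_cancel₀ hc0, map_one, one_smul] at h2
  obtain ⟨q, hq⟩ : ∃ q, Nat.find hex = q + 1 := Nat.exists_eq_succ_of_ne_zero (by
    have := i.2
    omega)
  have hlt : q < Nat.find hex := by omega
  apply Nat.find_min hex hlt
  let φ : Fin (q + 1) ≃ Fin (Nat.find hex) := finCongr hq.symm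
  let i' := φ.symm i
  refine ⟨fun j => z (φ (i'.succAbove j)), fun j => e (φ (i'.succAbove j)),
    fun j => hz _, le_antisymm ?_ ?_⟩
  · refine (Submodule.span_mono ?_).trans hspan.le
    rintro _ ⟨j, rfl⟩
    exact ⟨_, rfl⟩
  · have hsub : Submodule.span A (z '' {j | j ≠ i}) ≤
        Submodule.span A (Set.range fun j => z (φ (i'.succAbove j))) := by
      apply Submodule.span_mono
      rintro _ ⟨j, hj, rfl⟩
      have hj' : φ.symm j ≠ i' := fun h => hj (φ.symm.injective h)
      obtain ⟨l, hl⟩ := Fin.exists_succAbove_eq hj'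
      exact ⟨l, by simp [hl]⟩
    refine hspan.ge.trans (Submodule.span_le.2 ?_)
    rintro _ ⟨j, rfl⟩
    by_cases hj : j = i
    · exact hsub (hj ▸ hzi)
    · exact hsub (Submodule.subset_span ⟨j, hj, rfl⟩)

end Generators

end NCRing

namespace NCRing

open CategoryTheory CategoryTheory.Abelian

/-! ### Connecting maps and Ext in degrees 0, 1 and 2. -/

section Extension

variable {C : Type*} [Category.{v} C] [Abelian C] [HasExt.{v} C]

/-- The connecting map into `Ext¹` is the obstruction to extending along `S.f`. -/
theorem exists_extension_of_extClass_comp_eq_zero {S : ShortComplex C}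
    (hS : S.ShortExact) {Y : C} (f : S.X₁ ⟶ Y)
    (h : hS.extClass.comp (Ext.mk₀ f) (add_zero 1) = 0) : ∃ g : S.X₂ ⟶ Y, S.f ≫ g = f := by
  obtain ⟨x, hx⟩ := Ext.contravariant_sequence_exact₁ hS Y (Ext.mk₀ f) (add_zero 1) h
  obtain ⟨g, rfl⟩ := Ext.addEquiv₀.symm.surjective x
  refine ⟨g, ?_⟩
  apply Ext.addEquiv₀.symm.injective
  simpa using hx

end Extension

section Connecting

variable {k : Type u} [Field k] {C : Type*} [Category.{v} C] [Abelian C] [Linear k C]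
  [HasExt.{v} C]

/-- The iterated connecting map of two spliced short exact sequences. -/
noncomputable def doubleConnectingMap {S₁ S₂ : ShortComplex C} (hS₁ : S₁.ShortExact)
    (hS₂ : S₂.ShortExact) (j : S₁.X₁ ⟶ S₂.X₃) (Y : C) : (S₂.X₁ ⟶ Y) →ₗ[k] Ext S₁.X₃ Y 2 where
  toFun f := hS₁.extClass.comp ((Ext.mk₀ j).comp
    (hS₂.extClass.comp (Ext.mk₀ f) (add_zero 1)) (zero_add 1)) one_add_one_eq_two
  map_add' f g := by simp only [Ext.mk₀_add, Ext.comp_add]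
  map_smul' c f := by simp only [Ext.mk₀_smul, Ext.comp_smul, RingHom.id_apply]

/-- Both connecting maps are onto because higher Ext out of the projective middle terms vanishes. -/
theorem doubleConnectingMap_surjective {S₁ S₂ : ShortComplex C} (hS₁ : S₁.ShortExact)
    (hS₂ : S₂.ShortExact) (j : S₁.X₁ ⟶ S₂.X₃) [IsIso j] (Y : C) (h₁ : Projective S₁.X₂)
    (h₂ : Projective S₂.X₂) :
    Function.Surjective (doubleConnectingMap (k := k) hS₁ hS₂ j Y) := by
  intro x
  obtain ⟨y, rfl⟩ := Ext.contravariant_sequence_exact₃ hS₁ Y x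
    (Ext.eq_zero_of_projective _) one_add_one_eq_two
  obtain ⟨z, hz⟩ := Ext.contravariant_sequence_exact₃ hS₂ Y
    ((Ext.mk₀ (inv j)).comp y (zero_add 1)) (Ext.eq_zero_of_projective _) (add_zero 1)
  obtain ⟨f, rfl⟩ := Ext.addEquiv₀.symm.surjective z
  refine ⟨f, ?_⟩
  change hS₁.extClass.comp ((Ext.mk₀ j).comp
    (hS₂.extClass.comp (Ext.addEquiv₀.symm f) (add_zero 1)) (zero_add 1)) one_add_one_eq_two = _
  rw [hz]
  simp

theorem exists_extension_of_doubleConnectingMap_eq_zero {S₁ S₂ : ShortComplex C}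
    (hS₁ : S₁.ShortExact) (hS₂ : S₂.ShortExact) (j : S₁.X₁ ⟶ S₂.X₃) [IsIso j] {Y : C}
    (h₁ : Projective S₁.X₂) {f : S₂.X₁ ⟶ Y}
    (hf : doubleConnectingMap (k := k) hS₁ hS₂ j Y f = 0) : ∃ g : S₂.X₂ ⟶ Y, S₂.f ≫ g = f := by
  obtain ⟨y, hy⟩ := Ext.contravariant_sequence_exact₁ hS₁ Y _ one_add_one_eq_two hf
  rw [Ext.eq_zero_of_projective y, Ext.comp_zero] at hy
  apply exists_extension_of_extClass_comp_eq_zero hS₂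
  have h := congrArg (fun t => (Ext.mk₀ (inv j)).comp t (zero_add 1)) hy
  simpa using h.symm

/-- Dimension shifting presents `Ext²` as `Hom(S₂.X₁, Y)` modulo the maps that extend to `S₂.X₂`; if
`Ext²` is a line, this quotient is recorded by one linear form. -/
theorem exists_functional_of_linearEquiv {S₁ S₂ : ShortComplex C}
    (hS₁ : S₁.ShortExact) (hS₂ : S₂.ShortExact) (j : S₁.X₁ ⟶ S₂.X₃) [IsIso j] {Y : C}
    (h₁ : Projective S₁.X₂) (h₂ : Projective S₂.X₂) (e : Ext S₁.X₃ Y 2 ≃ₗ[k] k) :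
    ∃ θ : (S₂.X₁ ⟶ Y) →+ k, Function.Surjective θ ∧ (∀ (c : k) f, θ (c • f) = c * θ f) ∧
      ∀ f, θ f = 0 → ∃ g : S₂.X₂ ⟶ Y, S₂.f ≫ g = f :=
  let θ := e.toLinearMap ∘ₗ doubleConnectingMap hS₁ hS₂ j Y
  ⟨θ.toAddMonoidHom, e.surjective.comp (doubleConnectingMap_surjective hS₁ hS₂ j Y h₁ h₂),
    θ.map_smul, fun _ hf =>
      exists_extension_of_doubleConnectingMap_eq_zero hS₁ hS₂ j h₁
        (e.injective (hf.trans (map_zero e).symm))⟩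

end Connecting

section Homological

variable {A : Type v} [Ring A]

/-- The short exact sequence attached to a submodule. -/
noncomputable abbrev submoduleSequence {M : Type v} [AddCommGroup M] [Module A M]
    (N : Submodule A M) : ShortComplex (ModuleCat.{v} A) :=
  ShortComplex.mk (ModuleCat.ofHom N.subtype) (ModuleCat.ofHom N.mkQ) (by ext; simp)

theorem submoduleSequence_shortExact {M : Type v} [AddCommGroup M] [Module A M]
    (N : Submodule A M) : (submoduleSequence N).ShortExact where
  exact := by
    rw [ShortComplex.ShortExact.moduleCat_exact_iff_function_exact]
    exact LinearMap.exact_subtype_mkQ N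
  mono_f := (ModuleCat.mono_iff_injective _).2 N.injective_subtype
  epi_g := (ModuleCat.epi_iff_surjective _).2 N.mkQ_surjective

/-- The short exact sequence attached to a surjective linear map. -/
noncomputable abbrev kernelSequence {M N : Type v} [AddCommGroup M] [Module A M] [AddCommGroup N]
    [Module A N] (f : M →ₗ[A] N) : ShortComplex (ModuleCat.{v} A) :=
  ShortComplex.mk (ModuleCat.ofHom (LinearMap.ker f).subtype) (ModuleCat.ofHom f) (by ext; simp)

theorem kernelSequence_shortExact {M N : Type v} [AddCommGroup M] [Module A M] [AddCommGroup N]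
    [Module A N] (f : M →ₗ[A] N) (hf : Function.Surjective f) :
    (kernelSequence f).ShortExact where
  exact := by
    rw [ShortComplex.ShortExact.moduleCat_exact_iff_function_exact]
    exact LinearMap.exact_subtype_ker_map f
  mono_f := (ModuleCat.mono_iff_injective _).2 (LinearMap.ker f).injective_subtype
  epi_g := (ModuleCat.epi_iff_surjective _).2 hf

theorem hasProjectiveDimensionLT_of_globalDimension {d : ℕ}
    (h : globalDimension A = (d : WithBot ℕ∞)) (M : ModuleCat.{v} A) :
    HasProjectiveDimensionLT M (d + 1) := by
  have h1 : projectiveDimension M ≤ d := h ▸ le_iSup (fun M => projectiveDimension M) M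
  exact (projectiveDimension_le_iff M d).1 h1

theorem linearMap_eq_zero_of_ext_zero {M N : Type v} [AddCommGroup M] [Module A M]
    [AddCommGroup N] [Module A N]
    (h : Subsingleton (Ext (ModuleCat.of A M) (ModuleCat.of A N) 0)) (f : M →ₗ[A] N) : f = 0 := by
  have h1 := Ext.addEquiv₀.symm.injective (Subsingleton.elim
    (Ext.addEquiv₀.symm (ModuleCat.ofHom f)) (Ext.addEquiv₀.symm 0))
  exact congrArg ModuleCat.Hom.hom h1

end Homological

section Presentation

variable {A : Type v} [Ring A]

/-- Dimension shifting: this kernel is a second syzygy of `A ⧸ I`. -/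
theorem projective_ker_of_hasProjectiveDimensionLT (I : Ideal A) {n : ℕ}
    (φ : (Fin n → A) →ₗ[A] I) (hφ : Function.Surjective φ)
    (h : HasProjectiveDimensionLT (ModuleCat.of A (A ⧸ I)) 3) :
    Module.Projective A (LinearMap.ker φ) := by
  have hA : Projective (ModuleCat.of A A) := inferInstance
  have hn : Projective (ModuleCat.of A (Fin n → A)) :=
    (IsProjective.iff_projective (Fin n → A)).1 inferInstance
  have h1 : HasProjectiveDimensionLT (submoduleSequence I).X₁ 2 :=
    ((submoduleSequence_shortExact I).hasProjectiveDimensionLT_X₃_iff 1 hA).1 h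
  have h2 : HasProjectiveDimensionLT (kernelSequence φ).X₁ 1 :=
    ((kernelSequence_shortExact φ hφ).hasProjectiveDimensionLT_X₃_iff 0 hn).1 h1
  have h3 : Projective (ModuleCat.of A (LinearMap.ker φ)) :=
    projective_iff_hasProjectiveDimensionLT_one.2 h2
  exact (IsProjective.iff_projective _).2 h3

/-- The map extends to `A`, where it is determined by the image of `1`. -/
theorem exists_mul_right_of_ext_one (I : Ideal A)
    (h : Subsingleton (Ext (ModuleCat.of A (A ⧸ I)) (ModuleCat.of A A) 1)) (f : I →ₗ[A] A) :
    ∃ b : A, ∀ x : I, f x = x * b := by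
  obtain ⟨g, hg⟩ := exists_extension_of_extClass_comp_eq_zero (submoduleSequence_shortExact I)
    (Y := ModuleCat.of A A) (ModuleCat.ofHom f) (Subsingleton.elim (α := Ext _ _ _) (h := h) _ _)
  let g' : A →ₗ[A] A := g.hom
  refine ⟨g' 1, fun x => ?_⟩
  have h1 : g' (x : A) = f x := congrArg (fun t => t.hom x) hg
  rw [← h1, ← smul_eq_mul, ← map_smul, smul_eq_mul, mul_one]

theorem eq_zero_of_ext_zero (I : Ideal A)
    (h : Subsingleton (Ext (ModuleCat.of A (A ⧸ I)) (ModuleCat.of A A) 0)) {b : A}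
    (hb : ∀ x ∈ I, x * b = 0) : b = 0 := by
  have h1 := linearMap_eq_zero_of_ext_zero h
    (Submodule.liftQ I (LinearMap.toSpanSingleton A A b) fun x hx => by simpa using hb x hx)
  have h2 := congrArg (fun f : A ⧸ I →ₗ[A] A => f (Submodule.Quotient.mk 1)) h1
  simpa using h2

variable {k : Type u} [Field k] [Algebra k A]

/-- A two-step presentation of `A ⧸ I` computes `Ext² (A ⧸ I, A)` as a cokernel. -/
theorem exists_functional_of_ext_two (I : Ideal A) {n : ℕ}
    (φ : (Fin n → A) →ₗ[A] I) (hφ : Function.Surjective φ)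
    (e : Ext (ModuleCat.of A (A ⧸ I)) (ModuleCat.of A A) 2 ≃ₗ[k] k) :
    ∃ θ : (LinearMap.ker φ →ₗ[A] A) →+ k, Function.Surjective θ ∧
      (∀ (c : k) (f g : LinearMap.ker φ →ₗ[A] A), (∀ v, g v = algebraMap k A c * f v) →
        θ g = c * θ f) ∧
      ∀ f, θ f = 0 → ∃ g : (Fin n → A) →ₗ[A] A, ∀ v : LinearMap.ker φ, f v = g v := by
  have hA : Projective (ModuleCat.of A A) := inferInstance
  have hn : Projective (ModuleCat.of A (Fin n → A)) :=
    (IsProjective.iff_projective (Fin n → A)).1 inferInstance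
  obtain ⟨θ, hθ, hsmul, hker⟩ := exists_functional_of_linearEquiv (submoduleSequence_shortExact I)
    (kernelSequence_shortExact φ hφ) (𝟙 (ModuleCat.of A I)) hA hn e
  refine ⟨⟨⟨fun f => θ (ModuleCat.ofHom f), θ.map_zero⟩, fun f g => θ.map_add _ _⟩, ?_, ?_, ?_⟩
  · intro c
    obtain ⟨f, hf⟩ := hθ c
    exact ⟨f.hom, hf⟩
  · intro c f g hfg
    refine Eq.trans (congrArg θ ?_) (hsmul c (ModuleCat.ofHom f))
    ext v
    exact hfg v
  · intro f hf
    obtain ⟨g, hg⟩ := hker _ hf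
    exact ⟨g.hom, fun v => congrArg (fun t => t.hom v) hg.symm⟩

end Presentation

end NCRing

namespace NCRing

/-! ### The self-dual resolution of the trivial module. -/

section Koszul

variable {k : Type u} [Field k] {A : Type v} [Ring A] [Algebra k A]
variable (𝒜 : ℕ → Submodule k A) [GradedAlgebra 𝒜]

/-- Elements `x i` and `y i` such that `0 → A → Aⁿ → A → A / A_{≥ 1} → 0`, with maps given by
`y` and `x`, is exact, and likewise for the dual complex of right modules. -/
structure IsKoszul {n : ℕ} (x y : Fin n → A) : Prop where
  component_x : ∀ i, component 𝒜 0 (x i) = 0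
  component_y : ∀ i, component 𝒜 0 (y i) = 0
  left_span : ∀ a, component 𝒜 0 a = 0 → ∃ b : Fin n → A, ∑ i, b i * x i = a
  right_span : ∀ a, component 𝒜 0 a = 0 → ∃ b : Fin n → A, ∑ i, y i * b i = a
  relation : ∑ i, y i * x i = 0
  left_exact : ∀ a : Fin n → A, ∑ i, a i * x i = 0 → ∃ d, ∀ i, a i = d * y i
  right_exact : ∀ b : Fin n → A, ∑ i, y i * b i = 0 → ∃ d, ∀ i, b i = x i * d
  left_injective : ∀ d, (∀ i, d * y i = 0) → d = 0
  right_injective : ∀ d, (∀ i, x i * d = 0) → d = 0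

variable {𝒜}

/-- A projective module with finitely many generators, all of whose relations have coefficients in
the irrelevant ideal, is free on these generators. -/
theorem relations_trivial_of_projective {M : Type*} [AddCommGroup M] [Module A M]
    [Module.Projective A M] {p : ℕ} (z : Fin p → M)
    (hspan : Submodule.span A (Set.range z) = ⊤)
    (hrel : ∀ a : Fin p → A, ∑ i, a i • z i = 0 → ∀ i, component 𝒜 0 (a i) = 0) :
    LinearIndependent A z := by
  rw [Fintype.linearIndependent_iff]
  let ψ : (Fin p → A) →ₗ[A] M := Fintype.linearCombination A z
  have hψ : Function.Surjective ψ := by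
    rw [← LinearMap.range_eq_top, Fintype.range_linearCombination, hspan]
  obtain ⟨s, hs⟩ := Module.projective_lifting_property ψ LinearMap.id hψ
  have hs' : ∀ m, ψ (s m) = m := fun m => LinearMap.congr_fun hs m
  let l : Fin p → Fin p → A := fun i => Pi.single i 1 - s (z i)
  have hl : ∀ i, ∑ j, l i j • z j = 0 := fun i => by
    change ψ (Pi.single i 1 - s (z i)) = 0
    rw [map_sub, hs', sub_eq_zero]
    simp [ψ]
  have hexp : ∀ a : Fin p → A, ∑ i, a i • z i = 0 → ∀ j, a j = ∑ i, a i * l i j := by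
    intro a ha j
    have h1 : ∑ i, a i • s (z i) = 0 := by
      rw [← map_zero s, ← ha, map_sum]
      simp
    have h2 : a = ∑ i, a i • l i := by
      simp only [l, smul_sub, Finset.sum_sub_distrib, h1, sub_zero]
      ext j
      simp [Finset.sum_apply, Pi.single_apply]
    conv_lhs => rw [h2]
    simp [Finset.sum_apply]
  -- Relations have coefficients in `A_{≥1}` and are combinations, with these same coefficients, of
  -- the relations `l i` given by the splitting. Each pass therefore raises the order of vanishing
  -- by one.
  have hdeep : ∀ n, ∀ a : Fin p → A, ∑ i, a i • z i = 0 → ∀ j, VanishesBelow 𝒜 n (a j) := by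
    intro n
    induction n with
    | zero => intro a _ j i hi; omega
    | succ n ih =>
      intro a ha j
      rw [hexp a ha j, add_comm n 1]
      exact VanishesBelow.sum fun i _ =>
        (vanishesBelow_one_iff.2 (hrel a ha i)).mul (ih _ (hl i) j)
  exact fun a ha i => eq_zero_of_vanishesBelow fun n => hdeep n a ha i

/-- Global dimension 2 makes the first relation module `ker φ` of the `x i` free, and `Ext² ≅ k`
makes its rank one, with basis vector `y`. The statements about right multiples come from the dual
complex: generation by the `y i` from `Ext²`, exactness from `Ext¹ = 0`, injectivity from `Ext⁰ =
0`. -/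
theorem exists_isKoszul (hnoeth : IsNoetherianRing A) (hreg : IsASRegular 𝒜 2) :
    ∃ (n : ℕ) (x y : Fin n → A) (d : Fin n → ℕ) (c : ℕ), IsKoszul 𝒜 x y ∧
      (∀ i, x i ∈ 𝒜 (d i)) ∧ ∀ i, y i ∈ 𝒜 (c - d i) ∧ (d i ≤ c ∨ y i = 0) := by
  classical
  have hnt := hreg.connected.1.nontrivial
  have h10 : component 𝒜 0 (1 : A) = 1 := component_same SetLike.GradedOne.one_mem
  set I : Ideal A := (HomogeneousIdeal.irrelevant 𝒜).toIdeal
  have hmem : ∀ a, a ∈ I ↔ component 𝒜 0 a = 0 := fun a => mem_irrelevant_iff_component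
  obtain ⟨n, x, d, hx, hxspan, hxrel⟩ := exists_minimal_generators hreg.connected
    (GradedComponents.self 𝒜) I (fun j v hv => by
      rw [hmem] at hv ⊢
      change component 𝒜 0 (component 𝒜 j v) = 0
      rw [component_component]
      split_ifs with h
      · rw [h, hv]
      · rfl) (IsNoetherian.noetherian I)
  replace hx : ∀ i, x i ∈ 𝒜 (d i) := fun i => mem_of_component (hx i)
  have hxI : ∀ i, x i ∈ I := fun i => hxspan ▸ Submodule.subset_span ⟨i, rfl⟩
  let φ : (Fin n → A) →ₗ[A] I := (Fintype.linearCombination A x).codRestrict I fun a => by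
    rw [Fintype.linearCombination_apply]
    exact Submodule.sum_mem _ fun i _ => Submodule.smul_mem _ _ (hxI i)
  have hφ_apply : ∀ a, (φ a : A) = ∑ i, a i * x i := fun a => rfl
  have hφ : Function.Surjective φ := by
    rintro ⟨a, ha⟩
    have h1 : a ∈ LinearMap.range (Fintype.linearCombination A x) := by
      rw [Fintype.range_linearCombination, hxspan]
      exact ha
    obtain ⟨b, hb⟩ := h1
    exact ⟨b, Subtype.ext hb⟩
  have hker : ∀ v, v ∈ LinearMap.ker φ ↔ ∑ i, v i * x i = 0 := fun v => by
    rw [LinearMap.mem_ker, ← hφ_apply, ZeroMemClass.coe_eq_zero]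
  have hproj : Module.Projective A (LinearMap.ker φ) :=
    projective_ker_of_hasProjectiveDimensionLT I φ hφ
      (hasProjectiveDimensionLT_of_globalDimension hreg.globalDimension_eq _)
  obtain ⟨p, z, e, hz, hzspan, hzrel⟩ := exists_minimal_generators hreg.connected
    (GradedComponents.pi 𝒜 d) (LinearMap.ker φ) (fun j v hv => by
      rw [hker] at hv ⊢
      have h1 := congrArg (component 𝒜 j) hv
      rw [map_sum, map_zero] at h1
      refine Eq.trans (Finset.sum_congr rfl fun i _ => ?_) h1
      rw [component_mul_right (hx i)]
      change (if d i ≤ j then component 𝒜 (j - d i) (v i) else 0) * x i = _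
      split_ifs
      · rfl
      · rw [zero_mul]) (IsNoetherian.noetherian _)
  have hzK : ∀ i, z i ∈ LinearMap.ker φ := fun i => hzspan ▸ Submodule.subset_span ⟨i, rfl⟩
  let z' : Fin p → LinearMap.ker φ := fun i => ⟨z i, hzK i⟩
  have hz'span : Submodule.span A (Set.range z') = ⊤ := by
    apply Submodule.map_injective_of_injective (LinearMap.ker φ).injective_subtype
    rw [Submodule.map_span, Submodule.map_subtype_top, ← Set.range_comp]
    exact hzspan
  have hli : LinearIndependent A z' := relations_trivial_of_projective (𝒜 := 𝒜) z' hz'span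
    fun a ha => hzrel a (by simpa [z'] using congrArg Subtype.val ha)
  let b := Module.Basis.mk hli hz'span.ge
  have hb : ∀ i, b i = z' i := fun i => Module.Basis.mk_apply hli hz'span.ge i
  obtain ⟨θ, hθ, hθsmul, hθker⟩ := exists_functional_of_ext_two I φ hφ hreg.ext_iso.some
  have hval : ∀ g : (Fin n → A) →ₗ[A] A, ∀ v, g v = ∑ i, v i * g (Pi.single i 1) := by
    intro g v
    rw [LinearMap.pi_apply_eq_sum_univ g v]
    refine Finset.sum_congr rfl fun i _ => ?_
    rw [smul_eq_mul]
    congr 2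
    ext j
    simp [Pi.single_apply, eq_comm]
  have hzm : ∀ v ∈ LinearMap.ker φ, ∀ i, component 𝒜 0 (v i) = 0 := fun v hv =>
    hxrel v ((hker v).1 hv)
  -- By minimality `ker φ` lies in `A_{≥1}ⁿ`, so functionals that extend to `Aⁿ` take values in
  -- `A_{≥1}` on it. Coordinate functionals do not, so `θ` is nonzero on each, and two of them would
  -- give a combination in the kernel of `θ` with a value `1`.
  have hval0 : ∀ g : (Fin n → A) →ₗ[A] A, ∀ v ∈ LinearMap.ker φ, component 𝒜 0 (g v) = 0 := by
    intro g v hv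
    rw [hval, map_sum]
    exact Finset.sum_eq_zero fun i _ => by rw [component_zero_mul, hzm v hv, zero_mul]
  have hsmul : ∀ (c : k) f, θ (c • f) = c * θ f := fun c f =>
    hθsmul c f _ fun v => by rw [LinearMap.smul_apply, Algebra.smul_def]
  have hcoord : ∀ i, θ (b.coord i) ≠ 0 := by
    intro i h0
    obtain ⟨g, hg⟩ := hθker _ h0
    have h1 := hg (b i)
    rw [Module.Basis.coord_apply, Module.Basis.repr_self, Finsupp.single_eq_same] at h1
    have h2 := hval0 g _ (b i).2
    rw [← h1, h10] at h2
    exact one_ne_zero h2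
  have hp : ∀ i j : Fin p, i = j := by
    intro i j
    by_contra hij
    have h0 : θ (b.coord i - (θ (b.coord i) / θ (b.coord j)) • b.coord j) = 0 := by
      rw [map_sub, hsmul, div_mul_cancel₀ _ (hcoord j), sub_self]
    obtain ⟨g, hg⟩ := hθker _ h0
    have h1 := hg (b i)
    have h2 := hval0 g _ (b i).2
    rw [← h1] at h2
    simp [hij, h10] at h2
  obtain ⟨o⟩ : Nonempty (Fin p) := by
    by_contra hne
    rw [not_nonempty_iff] at hne
    obtain ⟨f, hf⟩ := hθ 1
    have : f = 0 := b.ext fun i => hne.elim i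
    rw [this, map_zero] at hf
    exact zero_ne_one hf
  have hK : ∀ v ∈ LinearMap.ker φ, ∃ a : A, v = a • z o := by
    intro v hv
    refine ⟨b.coord o ⟨v, hv⟩, ?_⟩
    have h1 := b.sum_repr ⟨v, hv⟩
    rw [Finset.sum_eq_single o (fun j _ hj => absurd (hp j o) hj) (by simp), hb] at h1
    exact (congrArg Subtype.val h1).symm
  have hfree : ∀ a : A, a • z o = 0 → a = 0 := by
    intro a ha
    refine Fintype.linearIndependent_iff.1 hli (fun _ => a) ?_ o
    rw [Finset.sum_eq_single o (fun j _ hj => absurd (hp j o) hj) (by simp)]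
    exact Subtype.ext ha
  refine ⟨n, x, z o, d, e o, ⟨fun i => (hmem _).1 (hxI i), hzm _ (hzK o), ?_, ?_, (hker _).1 (hzK o),
    ?_, ?_, ?_, ?_⟩, hx, ?_⟩
  · intro a ha
    obtain ⟨v, hv⟩ := hφ ⟨a, (hmem a).2 ha⟩
    exact ⟨v, congrArg Subtype.val hv⟩
  · intro a ha
    -- The functional sending the basis vector to `a` becomes extendable after subtracting `c` times
    -- the coordinate; as `a` has no constant term, `c` must vanish, and the extension displays `a`
    -- as a right combination of the `y i`.
    set f : LinearMap.ker φ →ₗ[A] A := (b.coord o).smulRight a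
    set c := θ f / θ (b.coord o)
    have h0 : θ (f - c • b.coord o) = 0 := by
      rw [map_sub, hsmul, div_mul_cancel₀ _ (hcoord o), sub_self]
    obtain ⟨g, hg⟩ := hθker _ h0
    have h1 := hg (b o)
    have h2 := hval0 g _ (b o).2
    have h3 : (f - c • b.coord o) (b o) = a - c • (1 : A) := by simp [f]
    rw [← h1, h3, map_sub, map_smul, ha, h10, zero_sub, neg_eq_zero] at h2
    rw [h3, h2, sub_zero, hb] at h1
    exact ⟨fun i => g (Pi.single i 1), (hval g _).symm.trans h1.symm⟩
  · intro a ha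
    obtain ⟨t, ht⟩ := hK a ((hker a).2 ha)
    exact ⟨t, fun i => congrFun ht i⟩
  · intro t ht
    -- The row `t` kills the relations, so it descends to a map on `I` sending `x i` to `t i`; `Ext¹
    -- = 0` turns that map into a right multiplication.
    have hle : LinearMap.ker φ ≤ LinearMap.ker (Fintype.linearCombination A t) := by
      intro v hv
      obtain ⟨a, rfl⟩ := hK v hv
      rw [LinearMap.mem_ker, map_smul, Fintype.linearCombination_apply]
      simp only [smul_eq_mul, ht, mul_zero]
    let f : I →ₗ[A] A := (LinearMap.ker φ).liftQ _ hle ∘ₗ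
      (φ.quotKerEquivOfSurjective hφ).symm.toLinearMap
    obtain ⟨r, hr⟩ := exists_mul_right_of_ext_one I (hreg.ext_eq_zero 1 (by norm_num)) f
    refine ⟨r, fun i => ?_⟩
    have h1 : φ (Pi.single i 1) = ⟨x i, hxI i⟩ := Subtype.ext (by simp [hφ_apply, Pi.single_apply])
    have h2 : (φ.quotKerEquivOfSurjective hφ).symm ⟨x i, hxI i⟩ =
        Submodule.Quotient.mk (Pi.single i 1) := by
      rw [LinearEquiv.symm_apply_eq, ← h1]
      rfl
    have h3 := hr ⟨x i, hxI i⟩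
    rw [← h3]
    simp only [f, LinearMap.comp_apply, LinearEquiv.coe_coe, h2]
    rw [Submodule.liftQ_apply, Fintype.linearCombination_apply]
    simp [Pi.single_apply]
  · intro a ha
    exact hfree a (funext ha)
  · intro t ht
    refine eq_zero_of_ext_zero I (hreg.ext_eq_zero 0 (by norm_num)) fun a ha => ?_
    obtain ⟨v, hv⟩ := hφ ⟨a, ha⟩
    have h1 : ∑ i, v i * x i = a := congrArg Subtype.val hv
    rw [← h1, Finset.sum_mul]
    exact Finset.sum_eq_zero fun i _ => by rw [mul_assoc, ht, mul_zero]
  · intro i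
    have h1 : (if d i ≤ e o then component 𝒜 (e o - d i) (z o i) else 0) = z o i :=
      congrFun (hz o) i
    split_ifs at h1 with h
    · exact ⟨mem_of_component h1, Or.inl h⟩
    · rw [← h1]
      exact ⟨Submodule.zero_mem _, Or.inr rfl⟩

end Koszul

open DirectSum MulOpposite

/-! ### Passage to the opposite algebra. -/

section Opposite

variable {k : Type u} [Field k] {A : Type v} [Ring A] [Algebra k A]

/-- The grading on the opposite algebra. -/
def opGrading (𝒜 : ℕ → Submodule k A) (n : ℕ) : Submodule k Aᵐᵒᵖ :=
  (𝒜 n).comap (opLinearEquiv k).symm.toLinearMap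

theorem mem_opGrading {𝒜 : ℕ → Submodule k A} {n : ℕ} {a : Aᵐᵒᵖ} :
    a ∈ opGrading 𝒜 n ↔ unop a ∈ 𝒜 n := Iff.rfl

theorem isConnectedGraded_op {𝒜 : ℕ → Submodule k A} (h : IsConnectedGraded 𝒜) : IsConnectedGraded (opGrading 𝒜) := by
  refine ⟨fun a b hab => h.1 (congrArg unop hab), fun a => ?_⟩
  rw [mem_opGrading, h.2]
  exact exists_congr fun c => ⟨fun hc => unop_injective hc, fun hc => congrArg unop hc⟩

variable (𝒜 : ℕ → Submodule k A) [GradedAlgebra 𝒜]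

/-- The componentwise map to the opposite grading. -/
def opDirectSumMap : (⨁ i, 𝒜 i) →+ ⨁ i, opGrading 𝒜 i :=
  DirectSum.map fun _ =>
    { toFun := fun a => ⟨op a.1, a.2⟩
      map_zero' := rfl
      map_add' := fun _ _ => rfl }

/-- The grading on the opposite algebra. -/
instance opGradedAlgebra : GradedAlgebra (opGrading 𝒜) where
  one_mem := SetLike.GradedOne.one_mem (A := 𝒜)
  mul_mem i j a b ha hb := by
    rw [mem_opGrading, unop_mul, add_comm]
    exact SetLike.GradedMul.mul_mem hb ha
  toDecomposition := Decomposition.ofAddHom (opGrading 𝒜)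
    (((opDirectSumMap 𝒜).comp (decomposeAddEquiv 𝒜).toAddMonoidHom).comp
      opAddEquiv.symm.toAddMonoidHom)
    (by
      refine AddMonoidHom.ext fun a => ?_
      refine Decomposition.inductionOn 𝒜 (motive := fun a => ((DirectSum.coeAddMonoidHom
        (opGrading 𝒜)) (opDirectSumMap 𝒜 (decompose 𝒜 a))) = op a) ?_ ?_ ?_ (unop a)
      · simp
      · intro i a
        rw [decompose_coe]
        simp [opDirectSumMap]
      · intro a b ha hb
        rw [decompose_add, map_add, map_add, ha, hb, op_add])
    (by
      ext i a : 2
      simp only [AddMonoidHom.comp_apply, coeAddMonoidHom_of]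
      change opDirectSumMap 𝒜 (decompose 𝒜 (unop a.1)) = _
      rw [decompose_of_mem 𝒜 (mem_opGrading.1 a.2)]
      simp [opDirectSumMap])

variable {𝒜}

theorem component_op (n : ℕ) (a : Aᵐᵒᵖ) :
    component (opGrading 𝒜) n a = op (component 𝒜 n (unop a)) := by
  refine component_induction (𝒜 := opGrading 𝒜) (p := fun a => component (opGrading 𝒜) n a =
    op (component 𝒜 n (unop a))) a (by simp)
    (fun a b ha hb => by rw [map_add, ha, hb, unop_add, map_add, op_add]) fun m => ?_
  have h1 := component_mem (opGrading 𝒜) m a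
  rw [component_of_mem h1, component_of_mem (mem_opGrading.1 h1)]
  split_ifs <;> simp

theorem IsKoszul.opposite {n : ℕ} {x y : Fin n → A} (h : IsKoszul 𝒜 x y) :
    IsKoszul (opGrading 𝒜) (fun i => op (y i)) (fun i => op (x i)) where
  component_x i := by simp [component_op, h.component_y]
  component_y i := by simp [component_op, h.component_x]
  left_span a ha := by
    rw [component_op, op_eq_zero_iff] at ha
    obtain ⟨b, hb⟩ := h.right_span _ ha
    exact ⟨fun i => op (b i), unop_injective (by simpa using hb)⟩
  right_span a ha := by
    rw [component_op, op_eq_zero_iff] at ha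
    obtain ⟨b, hb⟩ := h.left_span _ ha
    exact ⟨fun i => op (b i), unop_injective (by simpa using hb)⟩
  relation := unop_injective (by simpa using h.relation)
  left_exact a ha := by
    obtain ⟨d, hd⟩ := h.right_exact (fun i => unop (a i)) (by
      simpa using congrArg unop ha)
    exact ⟨op d, fun i => unop_injective (hd i)⟩
  right_exact a ha := by
    obtain ⟨d, hd⟩ := h.left_exact (fun i => unop (a i)) (by
      simpa using congrArg unop ha)
    exact ⟨op d, fun i => unop_injective (hd i)⟩
  left_injective d hd := unop_injective (h.right_injective _ fun i => congrArg unop (hd i))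
  right_injective d hd := unop_injective (h.left_injective _ fun i => congrArg unop (hd i))

end Opposite

/-! ### Saturated graded left ideals are free. -/

section Saturated

variable {k : Type u} [Field k] {A : Type v} [Ring A] [Algebra k A]
variable {𝒜 : ℕ → Submodule k A} [GradedAlgebra 𝒜]

/-- A saturated graded left ideal is free on finitely many homogeneous elements. -/
theorem IsKoszul.exists_free_generators {n : ℕ} {x y : Fin n → A} (hK : IsKoszul 𝒜 x y)
    (hconn : IsConnectedGraded 𝒜) [IsNoetherianRing A] (I : Ideal A)
    (hI : ∀ n, ∀ a ∈ I, component 𝒜 n a ∈ I) (hsat : ∀ a, (∀ i, x i * a ∈ I) → a ∈ I) :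
    ∃ (p : ℕ) (f : Fin p → A) (e : Fin p → ℕ), (∀ i, f i ∈ 𝒜 (e i)) ∧
      Submodule.span A (Set.range f) = I ∧ LinearIndependent A f := by
  obtain ⟨p, f, e, hf, hspan, hrel⟩ := exists_minimal_generators hconn
    (GradedComponents.self 𝒜) I hI (IsNoetherian.noetherian I)
  refine ⟨p, f, e, fun i => mem_of_component (hf i), hspan, ?_⟩
  rw [Fintype.linearIndependent_iff]
  simp only [smul_eq_mul] at hrel ⊢
  have hdeep : ∀ N, ∀ a : Fin p → A, ∑ j, a j * f j = 0 → ∀ j, VanishesBelow 𝒜 N (a j) := by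
    intro N
    induction N with
    | zero => intro a _ j i hi; omega
    | succ N ih =>
      intro a ha
      -- Write `a j = ∑ y i * b j i`. Exactness gives `∑ j, b j i * f j = x i * d`, and saturation
      -- puts `d` in `I`. Correcting `b j i` by `x i * r j` yields relations again without changing
      -- `a j`, since `∑ y i * x i = 0`; so vanishing improves by one degree.
      choose b hb using fun j => hK.right_span (a j) (hrel a ha j)
      have h1 : ∑ i, y i * ∑ j, b j i * f j = 0 := by
        rw [← ha]
        simp only [Finset.mul_sum, ← mul_assoc]
        rw [Finset.sum_comm]
        exact Finset.sum_congr rfl fun j _ => by rw [← Finset.sum_mul, hb]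
      obtain ⟨d, hd⟩ := hK.right_exact _ h1
      have hdI : d ∈ I := hsat d fun i => by
        rw [← hd, ← hspan]
        exact Submodule.sum_mem _ fun j _ =>
          Submodule.smul_mem _ _ (Submodule.subset_span ⟨j, rfl⟩)
      rw [← hspan, Submodule.mem_span_range_iff_exists_fun] at hdI
      obtain ⟨r, hr⟩ := hdI
      simp only [smul_eq_mul] at hr
      have h2 : ∀ i, ∑ j, (b j i - x i * r j) * f j = 0 := fun i => by
        simp only [sub_mul, Finset.sum_sub_distrib, hd, mul_assoc]
        rw [← Finset.mul_sum, hr, sub_self]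
      intro j
      have h3 : a j = ∑ i, y i * (b j i - x i * r j) := by
        simp only [mul_sub, Finset.sum_sub_distrib, ← mul_assoc]
        rw [hb, ← Finset.sum_mul, hK.relation, zero_mul, sub_zero]
      rw [h3, add_comm N 1]
      exact VanishesBelow.sum fun i _ =>
        (vanishesBelow_one_iff.2 (hK.component_y i)).mul (ih _ (h2 i) j)
  exact fun a ha i => eq_zero_of_vanishesBelow fun N => hdeep N a ha i

/-- A saturated graded left ideal is principal. -/
theorem IsKoszul.exists_generator {n : ℕ} {x y : Fin n → A} (hK : IsKoszul 𝒜 x y)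
    (hconn : IsConnectedGraded 𝒜) [IsNoetherianRing A] (I : Ideal A)
    (hI : ∀ n, ∀ a ∈ I, component 𝒜 n a ∈ I) (hsat : ∀ a, (∀ i, x i * a ∈ I) → a ∈ I) :
    ∃ (f : A) (d : ℕ), f ∈ 𝒜 d ∧ ∀ a, a ∈ I ↔ ∃ b, b * f = a := by
  have := hconn.1.nontrivial
  obtain ⟨p, f, e, hf, hspan, hli⟩ := hK.exists_free_generators hconn I hI hsat
  -- The rank condition for noetherian rings bounds independent families in `A`.
  have hp : p ≤ 1 := by
    simpa using hli.fintype_card_le_finrank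
  interval_cases p
  · refine ⟨0, 0, Submodule.zero_mem _, fun a => ?_⟩
    rw [← hspan]
    simp [eq_comm]
  · refine ⟨f 0, e 0, hf 0, fun a => ?_⟩
    rw [← hspan, Submodule.mem_span_range_iff_exists_fun]
    simp only [Finset.univ_unique, Fin.default_eq_zero, Finset.sum_singleton, smul_eq_mul]
    exact ⟨fun ⟨c, hc⟩ => ⟨c 0, hc⟩, fun ⟨b, hb⟩ => ⟨fun _ => b, hb⟩⟩

/-- If a homogeneous element has a nonzero left annihilator, then this annihilator contains a
homogeneous element generating a free left ideal. -/
theorem IsKoszul.exists_left_regular {n : ℕ} {x y : Fin n → A} (hK : IsKoszul 𝒜 x y)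
    (hconn : IsConnectedGraded 𝒜) [IsNoetherianRing A] {a b : A} {d : ℕ} (ha : a ∈ 𝒜 d)
    (hb : b ≠ 0) (hba : b * a = 0) :
    ∃ (f : A) (e : ℕ), f ∈ 𝒜 e ∧ f * a = 0 ∧ ∀ c, c * f = 0 → c = 0 := by
  -- The left annihilator of `a` is saturated because no nonzero element is killed by all `x i` on
  -- the left.
  obtain ⟨p, f, e, hf, hspan, hli⟩ := hK.exists_free_generators hconn
    (LinearMap.ker (LinearMap.toSpanSingleton A A a))
    (fun m c hc => by
      simp only [LinearMap.mem_ker, LinearMap.toSpanSingleton_apply, smul_eq_mul] at hc ⊢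
      rw [← component_mul_right_add ha, hc, map_zero])
    (fun c hc => by
      simp only [LinearMap.mem_ker, LinearMap.toSpanSingleton_apply, smul_eq_mul,
        mul_assoc] at hc ⊢
      exact hK.right_injective _ hc)
  have hbmem : b ∈ Submodule.span A (Set.range f) := by
    rw [hspan]
    simpa using hba
  obtain ⟨i⟩ : Nonempty (Fin p) := by
    by_contra hne
    rw [not_nonempty_iff] at hne
    rw [Set.range_eq_empty, Submodule.span_empty, Submodule.mem_bot] at hbmem
    exact hb hbmem
  refine ⟨f i, e i, hf i, ?_, fun c hc => ?_⟩
  · have : f i ∈ LinearMap.ker (LinearMap.toSpanSingleton A A a) := by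
      rw [← hspan]
      exact Submodule.subset_span ⟨i, rfl⟩
    simpa using this
  · have h1 := Fintype.linearIndependent_iff.1 hli (Pi.single i c) (by
      simp [Pi.single_apply, hc]) i
    simpa using h1

end Saturated

/-! ### The algebra is a domain. -/

section Domain

/-- In a left noetherian ring, no product `f * a` vanishes if `f` is cancellable on the right and
`a` on the left. -/
theorem mul_ne_zero_of_regular {A : Type*} [Ring A] [Nontrivial A] [IsNoetherianRing A] {f a : A}
    (hf : ∀ c, c * f = 0 → c = 0) (ha : ∀ c, a * c = 0 → c = 0) : f * a ≠ 0 := by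
  intro hfa
  let L : ℕ →o Ideal A :=
    { toFun := fun m => LinearMap.ker (LinearMap.toSpanSingleton A A (a ^ m))
      monotone' := by
        intro m l hml c hc
        obtain ⟨t, rfl⟩ := Nat.exists_eq_add_of_le hml
        simp only [LinearMap.mem_ker, LinearMap.toSpanSingleton_apply, smul_eq_mul] at hc ⊢
        rw [pow_add, ← mul_assoc, hc, zero_mul] }
  have hL : ∀ m c, c ∈ L m ↔ c * a ^ m = 0 := fun m c => by
    change c ∈ LinearMap.ker _ ↔ _
    simp
  obtain ⟨m, hm⟩ := monotone_stabilizes_iff_noetherian.2 ‹IsNoetherianRing A› L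
  -- The left annihilators of the powers of `a` are constant from `m` on; the extra factor `a`
  -- ensures `f * q = 0`.
  set q := a ^ (m + 1) with hq
  have hqq : ∀ c, c * q * q = 0 → c * q = 0 := by
    intro c hc
    rw [mul_assoc, ← pow_add, ← hL, ← hm _ (by omega)] at hc
    rw [← hL, ← hm _ (by omega)]
    exact hc
  have hfq : f * q = 0 := by rw [hq, pow_succ', ← mul_assoc, hfa, zero_mul]
  -- The sum `A f + A q` is direct and `A f` is free of rank one, so `A ⊕ A q` embeds in the
  -- noetherian module `A`, which forces `q = 0`.
  let F : (A × Submodule.span A {q}) →ₗ[A] A :=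
    (LinearMap.toSpanSingleton A A f).coprod (Submodule.span A {q}).subtype
  have hF : Function.Injective F := by
    rw [← LinearMap.ker_eq_bot, LinearMap.ker_eq_bot']
    rintro ⟨c, ⟨w, hw⟩⟩ h
    obtain ⟨t, rfl⟩ := Submodule.mem_span_singleton.1 hw
    have h1 : c * f + t * q = 0 := by simpa [F] using h
    have h2 : t * q = 0 := by
      apply hqq
      have := congrArg (· * q) h1
      simpa [add_mul, mul_assoc, hfq] using this
    rw [h2, add_zero] at h1
    have h3 := hf c h1
    subst h3
    simp [h2]
  have hsub := IsNoetherian.subsingleton_of_prod_injective F hF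
  have hq0 : q = 0 := congrArg Subtype.val (Subsingleton.elim
    (⟨q, Submodule.mem_span_singleton_self q⟩ : Submodule.span A {q}) 0)
  have hreg : ∀ m c, a ^ m * c = 0 → c = 0 := by
    intro m
    induction m with
    | zero => simp
    | succ m ih => exact fun c hc => ha c (ih _ (by rwa [pow_succ, mul_assoc] at hc))
  exact one_ne_zero (hreg (m + 1) 1 (by rw [← hq, hq0, zero_mul]))

variable {k : Type u} [Field k] {A : Type v} [Ring A] [Algebra k A]
variable {𝒜 : ℕ → Submodule k A} [GradedAlgebra 𝒜]

/-- If `a * b = 0`, the annihilator of `b` contains a homogeneous `f` cancellable on the right. On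
the opposite side, `f` annihilates some `g` cancellable on the left. This contradicts
`mul_ne_zero_of_regular`. -/
theorem IsKoszul.mul_ne_zero_of_mem {n : ℕ} {x y : Fin n → A} (hK : IsKoszul 𝒜 x y)
    (hconn : IsConnectedGraded 𝒜) [IsNoetherianRing A] [IsNoetherianRing Aᵐᵒᵖ] {a b : A} {d : ℕ}
    (hb : b ∈ 𝒜 d) (ha0 : a ≠ 0) (hb0 : b ≠ 0) : a * b ≠ 0 := by
  intro hab
  have := hconn.1.nontrivial
  obtain ⟨f, e, hf, hfb, hreg⟩ := hK.exists_left_regular hconn hb ha0 hab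
  obtain ⟨g, _, _, hg0, hg⟩ := hK.opposite.exists_left_regular (isConnectedGraded_op hconn)
    (a := op f) (b := op b) (d := e) hf (by simpa using hb0) (by simp [← op_mul, hfb])
  refine mul_ne_zero_of_regular hreg (a := unop g) (fun c hc => ?_) (congrArg unop hg0)
  exact congrArg unop (hg (op c) (unop_injective hc))

theorem exists_lowest {a : A} (ha : a ≠ 0) :
    ∃ p, VanishesBelow 𝒜 p a ∧ component 𝒜 p a ≠ 0 := by
  classical
  have h := exists_component_ne_zero (𝒜 := 𝒜) ha
  exact ⟨Nat.find h, fun j hj => not_not.1 (Nat.find_min h hj), Nat.find_spec h⟩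

theorem VanishesBelow.sub_component {p : ℕ} {a : A} (h : VanishesBelow 𝒜 p a) :
    VanishesBelow 𝒜 (p + 1) (a - component 𝒜 p a) := by
  intro j hj
  rw [map_sub, component_component]
  split_ifs with hpj
  · rw [hpj, sub_self]
  · rw [h j (by omega), sub_zero]

theorem vanishesBelow_of_mem {p : ℕ} {a : A} (h : a ∈ 𝒜 p) : VanishesBelow 𝒜 p a :=
  fun _ hj => component_ne h hj.ne'

theorem component_add_mul {p q : ℕ} {a b : A} (ha : VanishesBelow 𝒜 p a)
    (hb : VanishesBelow 𝒜 q b) :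
    component 𝒜 (p + q) (a * b) = component 𝒜 p a * component 𝒜 q b := by
  have h1 : a * b = component 𝒜 p a * component 𝒜 q b + ((a - component 𝒜 p a) * b +
      component 𝒜 p a * (b - component 𝒜 q b)) := by noncomm_ring
  have h2 := ha.sub_component.mul hb (p + q) (by omega)
  have h3 := (vanishesBelow_of_mem (component_mem 𝒜 p a)).mul hb.sub_component (p + q) (by omega)
  rw [h1, map_add, map_add, h2, h3, add_zero, add_zero]
  exact component_same (SetLike.GradedMul.mul_mem (component_mem 𝒜 p a) (component_mem 𝒜 q b))

theorem IsKoszul.isDomain {n : ℕ} {x y : Fin n → A} (hK : IsKoszul 𝒜 x y)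
    (hconn : IsConnectedGraded 𝒜) [IsNoetherianRing A] [IsNoetherianRing Aᵐᵒᵖ] : IsDomain A := by
  have := hconn.1.nontrivial
  have : NoZeroDivisors A := ⟨fun {a b} hab => by
    by_contra! h
    obtain ⟨p, hp, hp0⟩ := exists_lowest (𝒜 := 𝒜) h.1
    obtain ⟨q, hq, hq0⟩ := exists_lowest (𝒜 := 𝒜) h.2
    refine hK.mul_ne_zero_of_mem hconn (component_mem 𝒜 q b) hp0 hq0 ?_
    rw [← component_add_mul hp hq, hab, map_zero]⟩
  exact NoZeroDivisors.to_isDomain A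

end Domain

/-! ### Generation by the `x i` and finite-dimensional components. -/

section Generation

variable {k : Type u} [Field k] {A : Type v} [Ring A] [Algebra k A]
variable {𝒜 : ℕ → Submodule k A} [GradedAlgebra 𝒜]

theorem algebraMap_mem_zero (c : k) : algebraMap k A c ∈ 𝒜 0 := SetLike.algebraMap_mem_graded 𝒜 c

theorem exists_scalar {𝒜 : ℕ → Submodule k A} (hconn : IsConnectedGraded 𝒜) {a : A} (h : a ∈ 𝒜 0) :
    ∃ c : k, a = algebraMap k A c := by
  obtain ⟨c, hc⟩ := (hconn.2 a).1 h
  exact ⟨c, hc.symm⟩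

theorem component_zero_one : component 𝒜 0 (1 : A) = 1 :=
  component_same SetLike.GradedOne.one_mem

theorem IsKoszul.degree_pos {n : ℕ} {x y : Fin n → A} (hK : IsKoszul 𝒜 x y) {i : Fin n} {d : ℕ}
    (hx : x i ∈ 𝒜 d) (h0 : x i ≠ 0) : 0 < d := by
  by_contra h
  rw [Nat.eq_zero_of_not_pos h] at hx
  exact h0 ((component_same hx).symm.trans (hK.component_x i))

/-- Each homogeneous element of positive degree is a left combination of the generators with
homogeneous coefficients. -/
theorem IsKoszul.exists_homogeneous_expansion {n : ℕ} {x y : Fin n → A} (hK : IsKoszul 𝒜 x y)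
    {d : Fin n → ℕ} (hx : ∀ i, x i ∈ 𝒜 (d i)) {m : ℕ} (hm : 0 < m) {a : A} (ha : a ∈ 𝒜 m) :
    ∃ b : Fin n → A, (∀ i, b i ∈ 𝒜 (m - d i)) ∧ (∀ i, b i ≠ 0 → 0 < d i ∧ d i ≤ m) ∧
      ∑ i, b i * x i = a := by
  classical
  obtain ⟨b, hb⟩ := hK.left_span a (component_ne ha hm.ne')
  refine ⟨fun i => if 0 < d i ∧ d i ≤ m then component 𝒜 (m - d i) (b i) else 0, fun i => ?_,
    fun i hi => ?_, ?_⟩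
  · dsimp only
    split_ifs
    · exact component_mem 𝒜 _ _
    · exact Submodule.zero_mem _
  · by_contra h
    exact hi (if_neg h)
  · rw [← component_same ha, ← hb, map_sum]
    refine Finset.sum_congr rfl fun i _ => ?_
    rw [component_mul_right (hx i)]
    by_cases h0 : x i = 0
    · simp [h0]
    · simp only [hK.degree_pos (hx i) h0, true_and]
      split_ifs <;> simp

theorem IsKoszul.generator_induction {n : ℕ} {x y : Fin n → A} (hK : IsKoszul 𝒜 x y)
    (hconn : IsConnectedGraded 𝒜) {d : Fin n → ℕ} (hx : ∀ i, x i ∈ 𝒜 (d i)) {p : A → Prop}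
    (hscalar : ∀ c : k, p (algebraMap k A c)) (hadd : ∀ a b, p a → p b → p (a + b))
    (hmul : ∀ a i, p a → p (a * x i)) (a : A) : p a := by
  have h0 : p 0 := by simpa using hscalar 0
  have key : ∀ m, ∀ a ∈ 𝒜 m, p a := by
    intro m
    induction m using Nat.strong_induction_on with
    | _ m ih =>
      intro a ha
      rcases Nat.eq_zero_or_pos m with rfl | hm
      · obtain ⟨c, rfl⟩ := exists_scalar hconn ha
        exact hscalar c
      · obtain ⟨b, hb, hb', rfl⟩ := hK.exists_homogeneous_expansion hx hm ha
        refine Finset.sum_induction _ p hadd h0 fun i _ => hmul _ _ ?_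
        by_cases hbi : b i = 0
        · rwa [hbi]
        · have := hb' i hbi
          exact ih (m - d i) (by omega) _ (hb i)
  exact component_induction (𝒜 := 𝒜) a h0 hadd fun m => key m _ (component_mem 𝒜 m a)

theorem IsKoszul.finiteDimensional {n : ℕ} {x y : Fin n → A} (hK : IsKoszul 𝒜 x y)
    (hconn : IsConnectedGraded 𝒜) {d : Fin n → ℕ} (hx : ∀ i, x i ∈ 𝒜 (d i)) (m : ℕ) :
    FiniteDimensional k (𝒜 m) := by
  classical
  induction m using Nat.strong_induction_on with
  | _ m ih =>
    rcases Nat.eq_zero_or_pos m with rfl | hm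
    · have : 𝒜 0 ≤ Submodule.span k {1} := fun a ha => by
        obtain ⟨c, rfl⟩ := exists_scalar hconn ha
        exact Submodule.mem_span_singleton.2 ⟨c, (Algebra.algebraMap_eq_smul_one c).symm⟩
      exact Submodule.finiteDimensional_of_le this
    · let S : Fin n → Submodule k A := fun i =>
        if 0 < d i ∧ d i ≤ m then (𝒜 (m - d i)).map (LinearMap.mulRight k (x i)) else ⊥
      have hS : ∀ i, FiniteDimensional k (S i) := fun i => by
        by_cases h : 0 < d i ∧ d i ≤ m
        · have := ih (m - d i) (by omega)
          rw [show S i = _ from if_pos h]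
          infer_instance
        · rw [show S i = _ from if_neg h]
          infer_instance
      have hle : 𝒜 m ≤ ⨆ i, S i := fun a ha => by
        obtain ⟨b, hb, hb', rfl⟩ := hK.exists_homogeneous_expansion hx hm ha
        refine Submodule.sum_mem _ fun i _ => Submodule.mem_iSup_of_mem i ?_
        by_cases hbi : b i = 0
        · rw [hbi, zero_mul]
          exact Submodule.zero_mem _
        · simp only [S, if_pos (hb' i hbi)]
          exact ⟨b i, hb i, rfl⟩
      exact Submodule.finiteDimensional_of_le hle

end Generation

/-! ### Normal elements and homogeneous tests. -/

section Normal

variable {k : Type u} [Field k] {A : Type v} [Ring A] [Algebra k A]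
variable {𝒜 : ℕ → Submodule k A} [GradedAlgebra 𝒜]

/-- In each degree `f 𝒜ₙ ⊆ 𝒜ₙ f`, and both spaces have the dimension of `𝒜 n`, so one-sided
normality is two-sided. -/
theorem exists_mul_eq_of_forall_exists_mul_eq [IsDomain A]
    (hfin : ∀ n, FiniteDimensional k (𝒜 n)) {f : A} {d : ℕ} (hf : f ∈ 𝒜 d) (hf0 : f ≠ 0)
    (h : ∀ a, ∃ b, b * f = f * a) (a : A) : ∃ b, f * b = a * f := by
  refine component_induction (𝒜 := 𝒜) (p := fun a => ∃ b, f * b = a * f) a ⟨0, by simp⟩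
    (fun a b ⟨a', ha⟩ ⟨b', hb⟩ => ⟨a' + b', by rw [mul_add, ha, hb, add_mul]⟩) fun n => ?_
  have hle : (𝒜 n).map (LinearMap.mulLeft k f) ≤ (𝒜 n).map (LinearMap.mulRight k f) := by
    rintro _ ⟨a, ha, rfl⟩
    obtain ⟨b, hb⟩ := h a
    refine ⟨component 𝒜 n b, component_mem 𝒜 n b, ?_⟩
    rw [LinearMap.mulRight_apply, LinearMap.mulLeft_apply, ← component_mul_right_add hf, hb,
      add_comm, component_mul_left_add hf, component_same ha]
  have hfin := hfin n
  have heq := Submodule.eq_of_le_of_finrank_eq hle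
    ((Submodule.equivMapOfInjective _ (mul_right_injective₀ hf0) _).finrank_eq.symm.trans
      (Submodule.equivMapOfInjective _ (mul_left_injective₀ hf0) _).finrank_eq)
  have hmem : component 𝒜 n a * f ∈ (𝒜 n).map (LinearMap.mulRight k f) :=
    ⟨_, component_mem 𝒜 n a, rfl⟩
  rw [← heq] at hmem
  obtain ⟨b, _, hb⟩ := hmem
  exact ⟨b, hb⟩

theorem isNormalElement_of_forall_exists {f : A} (h : ∀ a, ∃ b, b * f = f * a)
    (h' : ∀ a, ∃ b, f * b = a * f) : IsNormalElement f := by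
  apply Set.Subset.antisymm
  · rintro _ ⟨a, rfl⟩
    exact h' a
  · rintro _ ⟨a, rfl⟩
    exact h a

theorem mem_span_singleton_of_normal {f : A} (h : ∀ a, ∃ b, b * f = f * a) {a : A} :
    a ∈ TwoSidedIdeal.span {f} ↔ ∃ b, b * f = a := by
  let I : TwoSidedIdeal A := TwoSidedIdeal.mk' {a | ∃ b, b * f = a} ⟨0, zero_mul f⟩
    (fun ⟨a, ha⟩ ⟨b, hb⟩ => ⟨a + b, by rw [add_mul, ha, hb]⟩)
    (fun ⟨a, ha⟩ => ⟨-a, by rw [neg_mul, ha]⟩)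
    (fun {r _} ⟨a, ha⟩ => ⟨r * a, by rw [mul_assoc, ha]⟩)
    (fun {_ r} ⟨a, ha⟩ => by
      obtain ⟨b, hb⟩ := h r
      exact ⟨a * b, by rw [mul_assoc, hb, ← mul_assoc, ha]⟩)
  have hI : ∀ a, a ∈ I ↔ ∃ b, b * f = a := fun a => TwoSidedIdeal.mem_mk' ..
  constructor
  · intro ha
    rw [← hI]
    have : TwoSidedIdeal.span {f} ≤ I := TwoSidedIdeal.span_le.2 (by
      rintro _ rfl
      exact (hI _).2 ⟨1, one_mul _⟩)
    exact this ha
  · rintro ⟨b, rfl⟩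
    exact TwoSidedIdeal.mul_mem_left _ _ _ (TwoSidedIdeal.subset_span rfl)

theorem component_sub_sum_range (a : A) (p l : ℕ) :
    component 𝒜 l (a - ∑ j ∈ Finset.range p, component 𝒜 j a) =
      if l < p then 0 else component 𝒜 l a := by
  rw [map_sub, map_sum]
  simp only [component_component, Finset.sum_ite_eq', Finset.mem_range]
  split_ifs <;> simp

/-- Primeness of a graded ideal can be tested on homogeneous elements. -/
theorem isPrimeIdeal_of_homogeneous (Q : TwoSidedIdeal A) (hQ : ∀ n, ∀ a ∈ Q, component 𝒜 n a ∈ Q)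
    (h1 : (1 : A) ∉ Q)
    (h : ∀ i j, ∀ a ∈ 𝒜 i, ∀ b ∈ 𝒜 j, (∀ r, a * r * b ∈ Q) → a ∈ Q ∨ b ∈ Q) :
    IsPrimeIdeal Q := by
  classical
  refine ⟨fun hQ => h1 (hQ ▸ trivial), fun a b hab => ?_⟩
  by_contra! hcon
  -- Subtract the components below the first one outside `Q`; then leading components of products
  -- are products of leading components.
  have key : ∀ a, a ∉ Q → ∃ p a', a' - a ∈ Q ∧ VanishesBelow 𝒜 p a' ∧ component 𝒜 p a' ∉ Q := by
    intro a ha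
    have hex : ∃ p, component 𝒜 p a ∉ Q := by
      by_contra! hall
      exact ha (component_induction (𝒜 := 𝒜) (p := fun a => a ∈ Q) a Q.zero_mem
        (fun _ _ h h' => Q.add_mem h h') hall)
    refine ⟨Nat.find hex, a - ∑ j ∈ Finset.range (Nat.find hex), component 𝒜 j a, ?_, ?_, ?_⟩
    · rw [sub_sub_cancel_left]
      refine Q.neg_mem (Finset.sum_induction _ (fun a => a ∈ Q) (fun _ _ h h' => Q.add_mem h h')
        Q.zero_mem fun j hj => ?_)
      exact not_not.1 (Nat.find_min hex (Finset.mem_range.1 hj))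
    · intro l hl
      rw [component_sub_sum_range, if_pos hl]
    · rw [component_sub_sum_range, if_neg (lt_irrefl _)]
      exact Nat.find_spec hex
  obtain ⟨p, a', ha, hap, ha0⟩ := key a hcon.1
  obtain ⟨q, b', hb, hbq, hb0⟩ := key b hcon.2
  have hab' : ∀ r, a' * r * b' ∈ Q := fun r => by
    have h2 : a' * r * b' = (a' - a) * (r * b') + a * r * (b' - b) + a * r * b := by noncomm_ring
    rw [h2]
    exact Q.add_mem (Q.add_mem (Q.mul_mem_right _ _ ha) (Q.mul_mem_left _ _ hb)) (hab r)
  rcases h p q _ (component_mem 𝒜 p a') _ (component_mem 𝒜 q b') (fun r => by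
    refine component_induction (𝒜 := 𝒜)
      (p := fun r => component 𝒜 p a' * r * component 𝒜 q b' ∈ Q) r (by simp [Q.zero_mem])
      (fun _ _ h h' => by rw [mul_add, add_mul]; exact Q.add_mem h h') fun m => ?_
    have hm := component_mem 𝒜 m r
    have h2 := hQ (p + m + q) _ (hab' (component 𝒜 m r))
    rwa [component_add_mul (hap.mul (vanishesBelow_of_mem hm)) hbq,
      component_mul_right_add hm] at h2) with h | h
  · exact ha0 h
  · exact hb0 h

end Normal

/-! ### Two generators, one relation, and a homogeneous normal element. -/

section Existence

variable {k : Type u} [Field k] {A : Type v} [Ring A] [Algebra k A]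
variable {𝒜 : ℕ → Submodule k A} [GradedAlgebra 𝒜]

theorem IsKoszul.y_ne_zero [Nontrivial A] {n : ℕ} {x y : Fin n → A} (hK : IsKoszul 𝒜 x y)
    (i : Fin n) : y i ≠ 0 := by
  classical
  intro h
  obtain ⟨d, hd⟩ := hK.right_exact (Pi.single i 1) (by simp [Pi.single_apply, h])
  have h1 := hd i
  rw [Pi.single_eq_same] at h1
  have h2 := component_zero_mul (𝒜 := 𝒜) (x i) d
  rw [← h1, hK.component_x, zero_mul, component_zero_one] at h2
  exact one_ne_zero h2

theorem IsKoszul.x_ne_zero [Nontrivial A] {n : ℕ} {x y : Fin n → A} (hK : IsKoszul 𝒜 x y)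
    (i : Fin n) : x i ≠ 0 := fun h =>
  hK.opposite.y_ne_zero i (by simp [h])

/-- With three or more generators, a dependence between `x 0` and `x 1` is a relation with zero
entry at `2`. Being `d * y` with `y 2 ≠ 0`, it is trivial, contrary to the rank condition. -/
theorem IsKoszul.eq_two [IsNoetherianRing A] [IsDomain A] {n : ℕ} {x y : Fin n → A}
    (hK : IsKoszul 𝒜 x y) : n = 2 := by
  classical
  rcases Nat.lt_or_ge n 2 with hn | hn
  · interval_cases n
    · exact absurd (hK.left_injective 1 fun i => i.elim0) one_ne_zero
    · have h := hK.relation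
      simp only [Finset.univ_unique, Fin.default_eq_zero, Finset.sum_singleton] at h
      rcases mul_eq_zero.1 h with h | h
      · exact absurd h (hK.y_ne_zero 0)
      · exact absurd h (hK.x_ne_zero 0)
  · by_contra hne
    obtain ⟨m, rfl⟩ : ∃ m, n = m + 3 := ⟨n - 3, by omega⟩
    have hdep : ¬ LinearIndependent A ![x 0, x 1] := fun h => by
      have := h.fintype_card_le_finrank
      simp at this
    obtain ⟨g, hg, i, hi⟩ := Fintype.not_linearIndependent_iff.1 hdep
    rw [Fin.sum_univ_two] at hg
    let a : Fin (m + 3) → A := Pi.single 0 (g 0) + Pi.single 1 (g 1)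
    obtain ⟨d, hd⟩ := hK.left_exact a (by
      rw [← hg]
      simp [a, add_mul, Finset.sum_add_distrib, Pi.single_apply])
    have h0 : g 0 = d * y 0 := by simpa [a] using hd 0
    have h1 : g 1 = d * y 1 := by simpa [a] using hd 1
    have h2 : d * y 2 = 0 := by
      rw [← hd 2]
      simp [a, Fin.ext_iff, Nat.mod_eq_of_lt]
    have hd0 := (mul_eq_zero.1 h2).resolve_right (hK.y_ne_zero 2)
    rw [hd0, zero_mul] at h0 h1
    fin_cases i
    · exact hi h0
    · exact hi h1

theorem IsKoszul.reindex {n : ℕ} {x y : Fin n → A} (hK : IsKoszul 𝒜 x y)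
    (σ : Equiv.Perm (Fin n)) : IsKoszul 𝒜 (x ∘ σ) (y ∘ σ) where
  component_x i := hK.component_x _
  component_y i := hK.component_y _
  left_span a ha := by
    obtain ⟨b, hb⟩ := hK.left_span a ha
    exact ⟨b ∘ σ, (Equiv.sum_comp σ fun i => b i * x i).trans hb⟩
  right_span a ha := by
    obtain ⟨b, hb⟩ := hK.right_span a ha
    exact ⟨b ∘ σ, (Equiv.sum_comp σ fun i => y i * b i).trans hb⟩
  relation := (Equiv.sum_comp σ fun i => y i * x i).trans hK.relation
  left_exact a ha := by
    obtain ⟨d, hd⟩ := hK.left_exact (a ∘ σ.symm) (by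
      rw [← ha, ← Equiv.sum_comp σ]
      simp)
    exact ⟨d, fun i => by simpa using hd (σ i)⟩
  right_exact a ha := by
    obtain ⟨d, hd⟩ := hK.right_exact (a ∘ σ.symm) (by
      rw [← ha, ← Equiv.sum_comp σ]
      simp)
    exact ⟨d, fun i => by simpa using hd (σ i)⟩
  left_injective d hd := hK.left_injective d fun i => by simpa using hd (σ.symm i)
  right_injective d hd := hK.right_injective d fun i => by simpa using hd (σ.symm i)

/-- In an algebra with two generators and one nondegenerate quadratic relation, left multiplication
by the commutator of the generators is a twisted right multiplication. -/
theorem commutator_mul_generator {X Y : A} {a b c d : k}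
    (h : a • (X * X) + b • (Y * X) + c • (X * Y) + d • (Y * Y) = 0) :
    (b * c - a * d) • ((X * Y - Y * X) * X) =
      ((a * d - c * c) • X + (d * (b - c)) • Y) * (X * Y - Y * X) := by
  -- With `r` the relation, the difference of the two sides is `X * (c r) + Y * (d r) - r * (c X + d
  -- Y)`.
  have hid : (b * c - a * d) • ((X * Y - Y * X) * X) -
      ((a * d - c * c) • X + (d * (b - c)) • Y) * (X * Y - Y * X) =
      X * (c • (a • (X * X) + b • (Y * X) + c • (X * Y) + d • (Y * Y))) +
      Y * (d • (a • (X * X) + b • (Y * X) + c • (X * Y) + d • (Y * Y))) -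
      (a • (X * X) + b • (Y * X) + c • (X * Y) + d • (Y * Y)) * (c • X + d • Y) := by
    simp only [mul_add, add_mul, mul_sub, sub_mul, smul_mul_assoc, mul_smul_comm, mul_assoc,
      smul_sub, smul_add, smul_smul]
    module
  rw [h] at hid
  simpa [sub_eq_zero] using hid

end Existence

section Existence

variable {k : Type u} [Field k] {A : Type v} [Ring A] [Algebra k A]
variable {𝒜 : ℕ → Submodule k A} [GradedAlgebra 𝒜]

theorem IsKoszul.forall_exists_mul_eq {n : ℕ} {x y : Fin n → A} (hK : IsKoszul 𝒜 x y)
    (hconn : IsConnectedGraded 𝒜) {d : Fin n → ℕ} (hx : ∀ i, x i ∈ 𝒜 (d i)) {w : A}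
    (hw : ∀ i, ∃ b, b * w = w * x i) (a : A) : ∃ b, b * w = w * a := by
  refine hK.generator_induction hconn hx (p := fun a => ∃ b, b * w = w * a)
    (fun c => ⟨_, Algebra.commutes c w⟩)
    (fun a b ⟨a', ha⟩ ⟨b', hb⟩ => ⟨a' + b', by rw [add_mul, ha, hb, mul_add]⟩) ?_ a
  rintro a i ⟨b, hb⟩
  obtain ⟨c, hc⟩ := hw i
  exact ⟨b * c, by rw [mul_assoc, hc, ← mul_assoc, hb, mul_assoc]⟩

/-- If the first generator has smaller degree, the relation makes it normal. -/
theorem IsKoszul.exists_mul_eq_of_degree_lt {x y : Fin 2 → A} (hK : IsKoszul 𝒜 x y)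
    (hconn : IsConnectedGraded 𝒜) [Nontrivial A] {d : Fin 2 → ℕ} (hx : ∀ i, x i ∈ 𝒜 (d i))
    (hy1 : y 1 ∈ 𝒜 (d 0)) (hd : d 0 < d 1) (i : Fin 2) : ∃ b, b * x 0 = x 0 * x i := by
  have hd0 : 0 < d 0 := hK.degree_pos (hx 0) (hK.x_ne_zero 0)
  fin_cases i
  · exact ⟨x 0, rfl⟩
  -- Since `y 1` has degree `d 0 < d 1`, it is a scalar multiple of `x 0`; the relation then
  -- rewrites `x 0 * x 1` as a left multiple of `x 0`.
  · obtain ⟨b, hb, hb', hsum⟩ := hK.exists_homogeneous_expansion hx hd0 hy1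
    rw [Fin.sum_univ_two] at hsum
    have hb1 : b 1 = 0 := by
      by_contra h
      have := hb' 1 h
      omega
    have hb0 := hb 0
    rw [Nat.sub_self] at hb0
    obtain ⟨c, hc⟩ := exists_scalar hconn hb0
    rw [hb1, zero_mul, add_zero, hc, ← Algebra.smul_def] at hsum
    have hc0 : c ≠ 0 := by
      rintro rfl
      exact hK.y_ne_zero 1 (by rw [← hsum, zero_smul])
    have hrel := hK.relation
    rw [Fin.sum_univ_two, ← hsum, smul_mul_assoc] at hrel
    refine ⟨-(c⁻¹ • y 0), ?_⟩
    have h1 := congrArg (c⁻¹ • ·) hrel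
    simp only [smul_add, smul_smul, inv_mul_cancel₀ hc0, one_smul, smul_zero] at h1
    rw [neg_mul, smul_mul_assoc]
    exact (eq_neg_of_add_eq_zero_right h1).symm

theorem IsKoszul.exists_scalars {x y : Fin 2 → A} (hK : IsKoszul 𝒜 x y)
    (hconn : IsConnectedGraded 𝒜) {m : ℕ} (hm : 0 < m) (hx : ∀ i, x i ∈ 𝒜 m) {a : A}
    (ha : a ∈ 𝒜 m) : ∃ s t : k, a = s • x 0 + t • x 1 := by
  obtain ⟨b, hb, -, hsum⟩ := hK.exists_homogeneous_expansion hx hm ha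
  simp only [Nat.sub_self] at hb
  obtain ⟨s, hs⟩ := exists_scalar hconn (hb 0)
  obtain ⟨t, ht⟩ := exists_scalar hconn (hb 1)
  refine ⟨s, t, ?_⟩
  rw [Fin.sum_univ_two, hs, ht, ← Algebra.smul_def, ← Algebra.smul_def] at hsum
  exact hsum.symm

theorem IsKoszul.scalars_eq_zero [Nontrivial A] {x y : Fin 2 → A} (hK : IsKoszul 𝒜 x y)
    {s t : k} (h : s • y 0 + t • y 1 = 0) : s = 0 ∧ t = 0 := by
  obtain ⟨e, he⟩ := hK.right_exact ![algebraMap k A s, algebraMap k A t] (by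
    rw [Fin.sum_univ_two]
    simpa [← Algebra.commutes, ← Algebra.smul_def] using h)
  have key : ∀ (c : k) (i : Fin 2), algebraMap k A c = x i * e → c = 0 := by
    intro c i hc
    have h1 := component_zero_mul (𝒜 := 𝒜) (x i) e
    rw [← hc, hK.component_x, zero_mul, component_same (algebraMap_mem_zero c)] at h1
    exact (map_eq_zero (algebraMap k A)).1 h1
  exact ⟨key s 0 (he 0), key t 1 (he 1)⟩

/-- If both generators have the same degree, either their commutator or, if they commute, the first
generator is normal. -/
theorem IsKoszul.exists_mul_eq_of_degree_eq {x y : Fin 2 → A} (hK : IsKoszul 𝒜 x y)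
    (hconn : IsConnectedGraded 𝒜) [Nontrivial A] {m : ℕ} (hx : ∀ i, x i ∈ 𝒜 m)
    (hy : ∀ i, y i ∈ 𝒜 m) :
    ∃ (w : A) (N : ℕ), 0 < N ∧ w ∈ 𝒜 N ∧ w ≠ 0 ∧ ∀ i, ∃ b, b * w = w * x i := by
  have hm : 0 < m := hK.degree_pos (hx 0) (hK.x_ne_zero 0)
  by_cases hw : x 0 * x 1 - x 1 * x 0 = 0
  · refine ⟨x 0, m, hm, hx 0, hK.x_ne_zero 0, fun i => ⟨x i, ?_⟩⟩
    fin_cases i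
    · rfl
    · exact (sub_eq_zero.1 hw).symm
  · obtain ⟨a, b, hab⟩ := hK.exists_scalars hconn hm hx (hy 0)
    obtain ⟨c, d, hcd⟩ := hK.exists_scalars hconn hm hx (hy 1)
    have hrel := hK.relation
    rw [Fin.sum_univ_two, hab, hcd] at hrel
    have hrel1 : a • (x 0 * x 0) + b • (x 1 * x 0) + c • (x 0 * x 1) + d • (x 1 * x 1) = 0 := by
      rw [← hrel]
      simp only [add_mul, smul_mul_assoc]
      abel
    have hrel2 : d • (x 1 * x 1) + c • (x 0 * x 1) + b • (x 1 * x 0) + a • (x 0 * x 0) = 0 := by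
      rw [← hrel1]
      abel
    -- A vanishing determinant would make `c • y 0 - a • y 1` and `d • y 0 - b • y 1` zero, but the
    -- `y i` are linearly independent over `k`.
    have hD : b * c - a * d ≠ 0 := by
      intro h0
      have h1 := hK.scalars_eq_zero (s := c) (t := -a) (by
        rw [hab, hcd]
        match_scalars
        · ring
        · linear_combination h0)
      have h2 := hK.scalars_eq_zero (s := d) (t := -b) (by
        rw [hab, hcd]
        match_scalars
        · linear_combination -h0
        · ring)
      apply hK.y_ne_zero 0
      rw [hab, neg_eq_zero.1 h1.2, neg_eq_zero.1 h2.2, zero_smul, zero_smul, add_zero]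
    have key : ∀ {v v' : A}, (b * c - a * d) • v = v' * (x 0 * x 1 - x 1 * x 0) →
        ∃ b, b * (x 0 * x 1 - x 1 * x 0) = v := by
      intro v v' h
      refine ⟨(b * c - a * d)⁻¹ • v', ?_⟩
      rw [smul_mul_assoc, ← h, smul_smul, inv_mul_cancel₀ hD, one_smul]
    refine ⟨_, m + m, by omega, Submodule.sub_mem _ (SetLike.GradedMul.mul_mem (hx 0) (hx 1))
      (SetLike.GradedMul.mul_mem (hx 1) (hx 0)), hw, fun i => ?_⟩
    fin_cases i
    · exact key (commutator_mul_generator hrel1)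
    -- Exchanging the generators exchanges `a` with `d` and `b` with `c`, and negates the
    -- commutator.
    · have h := commutator_mul_generator hrel2
      rw [← neg_sub (x 0 * x 1), neg_mul, mul_neg, smul_neg, neg_inj] at h
      exact key (by rw [mul_comm b c, mul_comm a d]; exact h)

/-- There is a nonzero homogeneous element of positive degree that is normal. -/
theorem IsKoszul.exists_homogeneous_normal {n : ℕ} {x y : Fin n → A} (hK : IsKoszul 𝒜 x y)
    (hconn : IsConnectedGraded 𝒜) [IsNoetherianRing A] [IsDomain A] {d : Fin n → ℕ} {c : ℕ}
    (hx : ∀ i, x i ∈ 𝒜 (d i)) (hy : ∀ i, y i ∈ 𝒜 (c - d i) ∧ (d i ≤ c ∨ y i = 0)) :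
    ∃ (w : A) (N : ℕ), 0 < N ∧ w ∈ 𝒜 N ∧ w ≠ 0 ∧ ∀ a, ∃ b, b * w = w * a := by
  obtain rfl := hK.eq_two
  wlog hd : d 0 ≤ d 1 generalizing x y d
  · exact this (hK.reindex (Equiv.swap 0 1)) (d := d ∘ Equiv.swap 0 1) (fun i => hx _)
      (fun i => hy _) (by simpa using (not_le.1 hd).le)
  have hc : ∀ i, d i ≤ c := fun i => (hy i).2.resolve_right (hK.y_ne_zero i)
  have hd0 : ∀ i, 0 < d i := fun i => hK.degree_pos (hx i) (hK.x_ne_zero i)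
  -- The `x i` generate `A_{≥1}` on the left, so nothing nonzero has positive degree below `d 0`.
  -- Dually, the `y i` generate on the right with least degree `c - d 1`, which gives the reverse
  -- inequality.
  have hle : d 0 ≤ c - d 1 := by
    by_contra h
    have hpos : 0 < c - d 1 := by
      have h1 := hK.opposite.degree_pos (i := 1) (d := c - d 1) (hy 1).1
        (by simpa using hK.y_ne_zero 1)
      exact h1
    obtain ⟨b, -, hb, hsum⟩ := hK.exists_homogeneous_expansion hx hpos (hy 1).1
    refine hK.y_ne_zero 1 (hsum.symm.trans (Finset.sum_eq_zero fun i _ => ?_))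
    by_contra hne
    have h1 := hb i (fun h0 => hne (by rw [h0, zero_mul]))
    have h2 : d 0 ≤ d i := by fin_cases i <;> simp [hd]
    omega
  have hge : c - d 1 ≤ d 0 := by
    by_contra h
    obtain ⟨b, -, hb, hsum⟩ := hK.opposite.exists_homogeneous_expansion
      (d := fun i => c - d i) (fun i => (hy i).1) (hd0 0) (a := MulOpposite.op (x 0)) (hx 0)
    have h0 : MulOpposite.op (x 0) = 0 := hsum.symm.trans (Finset.sum_eq_zero fun i _ => by
      by_contra hne
      have h1 := hb i (fun h0 => hne (by rw [h0, zero_mul]))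
      have h2 : d i ≤ d 1 := by fin_cases i <;> simp [hd]
      omega)
    exact hK.x_ne_zero 0 (by simpa using h0)
  have heq : c - d 1 = d 0 := le_antisymm hge hle
  have hy1 : y 1 ∈ 𝒜 (d 0) := heq ▸ (hy 1).1
  rcases hd.lt_or_eq with hlt | hdd
  · exact ⟨x 0, d 0, hd0 0, hx 0, hK.x_ne_zero 0, hK.forall_exists_mul_eq hconn hx
      (hK.exists_mul_eq_of_degree_lt hconn hx hy1 hlt)⟩
  · have hdi : ∀ i, d i = d 0 := fun i => by fin_cases i <;> simp [hdd]
    obtain ⟨w, N, hN, hw, hw0, h⟩ := hK.exists_mul_eq_of_degree_eq hconn (m := d 0)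
      (fun i => hdi i ▸ hx i) (fun i => by
        have h1 := (hy i).1
        rwa [hdi i, hdd, heq] at h1)
    exact ⟨w, N, hN, hw, hw0, hK.forall_exists_mul_eq hconn hx h⟩

end Existence

/-! ### Prime ideals generated by homogeneous normal elements. -/

section Homogeneous

variable {k : Type u} [Field k] {A : Type v} [Ring A] [Algebra k A]
variable {𝒜 : ℕ → Submodule k A} [GradedAlgebra 𝒜]

/-- A principal left ideal of a Koszul domain is saturated. -/
theorem IsKoszul.exists_mul_eq_of_forall [IsDomain A] {n : ℕ} {x y : Fin n → A}
    (hK : IsKoszul 𝒜 x y) {u a : A} (hu : u ≠ 0) (h : ∀ i, ∃ b, b * u = x i * a) :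
    ∃ b, b * u = a := by
  choose t ht using h
  -- The relation kills `∑ y i * x i * a`; after cancelling `u`, exactness gives `t i = x i * b`,
  -- and injectivity gives `a = b * u`.
  have h1 : (∑ i, y i * t i) * u = 0 := by
    rw [Finset.sum_mul]
    simp only [mul_assoc, ht]
    simp only [← mul_assoc]
    rw [← Finset.sum_mul, hK.relation, zero_mul]
  obtain ⟨b, hb⟩ := hK.right_exact t ((mul_eq_zero.1 h1).resolve_right hu)
  refine ⟨b, sub_eq_zero.1 (hK.right_injective _ fun i => ?_)⟩
  rw [mul_sub, ← mul_assoc, ← hb, ht, sub_self]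

/-- A normal homogeneous element of minimal positive degree generates a prime ideal. -/
theorem IsKoszul.exists_prime_element {n : ℕ} {x y : Fin n → A} (hK : IsKoszul 𝒜 x y)
    (hconn : IsConnectedGraded 𝒜) [IsNoetherianRing A] [IsDomain A]
    (h : ∃ (w : A) (N : ℕ), 0 < N ∧ w ∈ 𝒜 N ∧ w ≠ 0 ∧ ∀ a, ∃ b, b * w = w * a) :
    ∃ (w : A) (N : ℕ), 0 < N ∧ w ∈ 𝒜 N ∧ w ≠ 0 ∧ (∀ a, ∃ b, b * w = w * a) ∧
      IsPrimeIdeal (TwoSidedIdeal.span {w}) := by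
  classical
  have hex : ∃ (N : ℕ), ∃ w, 0 < N ∧ w ∈ 𝒜 N ∧ w ≠ 0 ∧ ∀ a, ∃ b, b * w = w * a := by
    obtain ⟨w, N, h⟩ := h
    exact ⟨N, w, h⟩
  obtain ⟨N, ⟨u, hN, hu, hu0, hskew⟩, hmin⟩ :=
    (⟨Nat.find hex, Nat.find_spec hex, fun M hM => Nat.find_min' hex hM⟩ : ∃ N, (∃ w, 0 < N ∧
      w ∈ 𝒜 N ∧ w ≠ 0 ∧ ∀ a, ∃ b, b * w = w * a) ∧ ∀ M, (∃ w, 0 < M ∧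
      w ∈ 𝒜 M ∧ w ≠ 0 ∧ ∀ a, ∃ b, b * w = w * a) → N ≤ M)
  refine ⟨u, N, hN, hu, hu0, hskew, ?_⟩
  have hmem : ∀ {a}, a ∈ TwoSidedIdeal.span {u} ↔ ∃ b, b * u = a :=
    mem_span_singleton_of_normal hskew
  set Q := TwoSidedIdeal.span {u}
  have hQ : ∀ n, ∀ a ∈ Q, component 𝒜 n a ∈ Q := by
    intro m a ha
    obtain ⟨b, rfl⟩ := hmem.1 ha
    rw [component_mul_right hu]
    split_ifs
    · exact hmem.2 ⟨_, rfl⟩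
    · exact Q.zero_mem
  refine isPrimeIdeal_of_homogeneous Q hQ (fun h1 => ?_) fun i j a ha b hb hab => ?_
  · obtain ⟨c, hc⟩ := hmem.1 h1
    have h2 := component_zero_mul (𝒜 := 𝒜) c u
    rw [hc, component_ne hu hN.ne', mul_zero, component_zero_one] at h2
    exact one_ne_zero h2
  · by_contra! hcon
    -- This ideal inherits saturation from `A u`, so it is `A v` with `v` homogeneous; being stable
    -- under right multiplication, it makes `v` normal.
    let J : Ideal A :=
      { carrier := {c | ∀ r, c * r * b ∈ Q}
        zero_mem' := fun r => by simp [Q.zero_mem]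
        add_mem' := fun {c c'} hc hc' r => by
          rw [add_mul, add_mul]
          exact Q.add_mem (hc r) (hc' r)
        smul_mem' := fun s c hc r => by
          rw [smul_eq_mul, mul_assoc, mul_assoc, ← mul_assoc c]
          exact Q.mul_mem_left _ _ (hc r) }
    obtain ⟨v, e, hv, hgen⟩ := hK.exists_generator hconn J
      (fun m c hc r => by
        refine component_induction (𝒜 := 𝒜) (p := fun r => component 𝒜 m c * r * b ∈ Q) r
          (by simp [Q.zero_mem])
          (fun _ _ h h' => by rw [mul_add, add_mul]; exact Q.add_mem h h') fun l => ?_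
        have h2 := hQ (m + l + j) _ (hc (component 𝒜 l r))
        rwa [component_mul_right_add hb, component_mul_right_add (component_mem 𝒜 l r)] at h2)
      (fun c hc r => hmem.2 (hK.exists_mul_eq_of_forall hu0 fun i => hmem.1 (by
        simpa [mul_assoc] using hc i r)))
    have huJ : u ∈ J := fun r => by
      rw [mul_assoc]
      exact Q.mul_mem_right _ _ (hmem.2 ⟨1, one_mul _⟩)
    have hvJ : v ∈ J := (hgen v).2 ⟨1, one_mul _⟩
    obtain ⟨c, hc⟩ := (hgen u).1 huJ
    have hv0 : v ≠ 0 := by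
      rintro rfl
      exact hu0 (by rw [← hc, mul_zero])
    have hvskew : ∀ s, ∃ b, b * v = v * s := fun s => (hgen _).1 fun r => by
      rw [mul_assoc v]
      exact hvJ (s * r)
    rcases Nat.eq_zero_or_pos e with rfl | he
    · obtain ⟨s, hs⟩ := exists_scalar hconn hv
      have hs0 : s ≠ 0 := by
        rintro rfl
        exact hv0 (by rw [hs, map_zero])
      have h1 : (1 : A) ∈ J := (hgen 1).2 ⟨algebraMap k A s⁻¹, by
        rw [hs, ← map_mul, inv_mul_cancel₀ hs0, map_one]⟩
      exact hcon.2 (by simpa using h1 1)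
    -- Since `u = c * v`, minimality of `N` forces equal degrees; so `u` and `v` agree up to a
    -- nonzero scalar, and `a ∈ J` lies in `Q`.
    · have hle := hmin e ⟨v, he, hv, hv0, hvskew⟩
      have h1 := congrArg (component 𝒜 N) hc
      rw [component_same hu, component_mul_right hv] at h1
      have hNe : e = N := by
        by_contra hne
        rw [if_neg (by omega)] at h1
        exact hu0 h1.symm
      subst hNe
      rw [if_pos le_rfl, Nat.sub_self] at h1
      obtain ⟨s, hs⟩ := exists_scalar hconn (component_mem 𝒜 0 c)
      rw [hs] at h1
      have hs0 : s ≠ 0 := by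
        rintro rfl
        exact hu0 (by rw [← h1, map_zero, zero_mul])
      obtain ⟨t, ht⟩ := (hgen a).1 hab
      refine hcon.1 (hmem.2 ⟨t * algebraMap k A s⁻¹, ?_⟩)
      rw [← h1, mul_assoc, ← mul_assoc (algebraMap k A s⁻¹), ← map_mul, inv_mul_cancel₀ hs0,
        map_one, one_mul, ht]

theorem mul_mem_of_forall_generator_mem {n : ℕ} {x y : Fin n → A} (hK : IsKoszul 𝒜 x y)
    {P : TwoSidedIdeal A} {a b : A} (h : ∀ i, x i * a ∈ P) (hb : component 𝒜 0 b = 0) :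
    b * a ∈ P := by
  obtain ⟨c, rfl⟩ := hK.left_span b hb
  rw [Finset.sum_mul]
  exact Finset.sum_induction _ (fun a => a ∈ P) (fun _ _ h h' => P.add_mem h h') P.zero_mem
    fun i _ => by rw [mul_assoc]; exact P.mul_mem_left _ _ (h i)

/-- A prime ideal not containing all generators is saturated. -/
theorem IsKoszul.mem_of_forall_generator_mem {n : ℕ} {x y : Fin n → A} (hK : IsKoszul 𝒜 x y)
    {P : TwoSidedIdeal A} (hP : IsPrimeIdeal P) {i₀ : Fin n} (hi₀ : x i₀ ∉ P) {a : A}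
    (h : ∀ i, x i * a ∈ P) : a ∈ P :=
  (hP.2 (x i₀) a fun r => mul_mem_of_forall_generator_mem hK h (by
    rw [component_zero_mul, hK.component_x, zero_mul])).resolve_left hi₀

/-- A prime ideal which contains a nonzero homogeneous element but not all generators contains a
prime ideal generated by a homogeneous normal element. -/
theorem IsKoszul.exists_prime_element_of_homogeneous_mem {n : ℕ} {x y : Fin n → A}
    (hK : IsKoszul 𝒜 x y) (hconn : IsConnectedGraded 𝒜) [IsNoetherianRing A] [IsDomain A]
    {d : Fin n → ℕ} (hx : ∀ i, x i ∈ 𝒜 (d i)) {P : TwoSidedIdeal A} (hP : IsPrimeIdeal P)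
    {i₀ : Fin n} (hi₀ : x i₀ ∉ P) {g : A} {e : ℕ}
    (hg : g ∈ 𝒜 e) (hg0 : g ≠ 0) (hgP : g ∈ P) :
    ∃ (w : A) (N : ℕ), w ∈ 𝒜 N ∧ w ≠ 0 ∧ (∀ a, ∃ b, b * w = w * a) ∧
      IsPrimeIdeal (TwoSidedIdeal.span {w}) ∧ TwoSidedIdeal.span {w} ≤ P := by
  have hmul : ∀ a, (∀ m, component 𝒜 m a ∈ P) → ∀ b m,
      component 𝒜 m (b * a) ∈ P ∧ component 𝒜 m (a * b) ∈ P := by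
    intro a ha b m
    refine component_induction (𝒜 := 𝒜)
      (p := fun b => component 𝒜 m (b * a) ∈ P ∧ component 𝒜 m (a * b) ∈ P) b
      (by simp [P.zero_mem])
      (fun _ _ h h' => by
        rw [add_mul, mul_add, map_add, map_add]
        exact ⟨P.add_mem h.1 h'.1, P.add_mem h.2 h'.2⟩) fun l => ?_
    rw [component_mul_left (component_mem 𝒜 l b), component_mul_right (component_mem 𝒜 l b)]
    split_ifs
    · exact ⟨P.mul_mem_left _ _ (ha _), P.mul_mem_right _ _ (ha _)⟩
    · exact ⟨P.zero_mem, P.zero_mem⟩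
  -- The largest graded ideal inside `P`; it inherits both saturation and primeness from `P`.
  let I : Ideal A :=
    { carrier := {a | ∀ m, component 𝒜 m a ∈ P}
      zero_mem' := fun m => by simp [P.zero_mem]
      add_mem' := fun {a b} ha hb m => by
        rw [map_add]
        exact P.add_mem (ha m) (hb m)
      smul_mem' := fun b a ha m => (hmul a ha b m).1 }
  have hIP : ∀ a ∈ I, a ∈ P := fun a ha => component_induction (𝒜 := 𝒜) (p := fun a => a ∈ P) a
    P.zero_mem (fun _ _ h h' => P.add_mem h h') ha
  have hPI : ∀ j, ∀ a ∈ 𝒜 j, a ∈ P → a ∈ I := fun j a ha haP m => by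
    rw [component_of_mem ha]
    split_ifs
    · exact haP
    · exact P.zero_mem
  have hIcomp : ∀ m, ∀ a ∈ I, component 𝒜 m a ∈ I := fun m a ha =>
    hPI m _ (component_mem 𝒜 m a) (ha m)
  obtain ⟨f, N, hf, hgen⟩ := hK.exists_generator hconn I hIcomp
    (fun a ha m => by
      refine hK.mem_of_forall_generator_mem hP hi₀ fun i => ?_
      rw [← component_mul_left_add (hx i)]
      exact ha i _)
  have hf0 : f ≠ 0 := by
    rintro rfl
    obtain ⟨b, hb⟩ := (hgen g).1 (hPI e g hg hgP)
    exact hg0 (by rw [← hb, mul_zero])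
  have hfI : f ∈ I := (hgen f).2 ⟨1, one_mul _⟩
  have hskew : ∀ a, ∃ b, b * f = f * a := fun a => (hgen _).1 fun m => (hmul f hfI a m).2
  have hmem : ∀ {a}, a ∈ TwoSidedIdeal.span {f} ↔ a ∈ I := fun {a} =>
    (mem_span_singleton_of_normal hskew).trans (hgen a).symm
  refine ⟨f, N, hf, hf0, hskew, isPrimeIdeal_of_homogeneous (𝒜 := 𝒜) _
    (fun m a ha => hmem.2 (hIcomp m a (hmem.1 ha))) (fun h1 => hP.1 ?_)
    (fun i j a ha b hb hab => ?_), fun a ha => hIP a (hmem.1 ha)⟩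
  · exact (TwoSidedIdeal.one_mem_iff P).1 (hIP 1 (hmem.1 h1))
  · rw [hmem, hmem]
    exact (hP.2 a b fun r => hIP _ (hmem.1 (hab r))).imp (hPI i a ha) (hPI j b hb)

end Homogeneous

/-! ### Width of support and homogeneous common multiples. -/

section Support

variable {k : Type u} [Field k] {A : Type v} [Ring A] [Algebra k A]
variable (𝒜 : ℕ → Submodule k A) [GradedAlgebra 𝒜]

/-- All nonzero homogeneous components have degree in the interval `[p, p + l]`. -/
def SupportedIn (p l : ℕ) (a : A) : Prop := ∀ m, component 𝒜 m a ≠ 0 → p ≤ m ∧ m ≤ p + l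

variable {𝒜}

theorem SupportedIn.zero (p l : ℕ) : SupportedIn 𝒜 p l (0 : A) := fun m hm => by simp at hm

theorem SupportedIn.add {p l : ℕ} {a b : A} (ha : SupportedIn 𝒜 p l a)
    (hb : SupportedIn 𝒜 p l b) : SupportedIn 𝒜 p l (a + b) := by
  intro m hm
  by_cases h : component 𝒜 m a = 0
  · rw [map_add, h, zero_add] at hm
    exact hb m hm
  · exact ha m h

theorem SupportedIn.neg {p l : ℕ} {a : A} (ha : SupportedIn 𝒜 p l a) :
    SupportedIn 𝒜 p l (-a) := fun m hm => ha m (by simpa using hm)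

theorem SupportedIn.sub {p l : ℕ} {a b : A} (ha : SupportedIn 𝒜 p l a)
    (hb : SupportedIn 𝒜 p l b) : SupportedIn 𝒜 p l (a - b) := by
  rw [sub_eq_add_neg]
  exact ha.add hb.neg

theorem SupportedIn.mono {p l l' : ℕ} {a : A} (ha : SupportedIn 𝒜 p l a) (h : l ≤ l') :
    SupportedIn 𝒜 p l' a := fun m hm => by
  have := ha m hm
  omega

theorem SupportedIn.mul_left {p l d : ℕ} {a b : A} (ha : SupportedIn 𝒜 p l a) (hb : b ∈ 𝒜 d) :
    SupportedIn 𝒜 (d + p) l (b * a) := by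
  intro m hm
  rw [component_mul_left hb] at hm
  split_ifs at hm with h
  · have := ha (m - d) (right_ne_zero_of_mul hm)
    omega
  · exact absurd rfl hm

theorem SupportedIn.mul_right {p l d : ℕ} {a b : A} (ha : SupportedIn 𝒜 p l a) (hb : b ∈ 𝒜 d) :
    SupportedIn 𝒜 (p + d) l (a * b) := by
  intro m hm
  rw [component_mul_right hb] at hm
  split_ifs at hm with h
  · have := ha (m - d) (left_ne_zero_of_mul hm)
    omega
  · exact absurd rfl hm

theorem SupportedIn.vanishesBelow {p l : ℕ} {a : A} (ha : SupportedIn 𝒜 p l a) :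
    VanishesBelow 𝒜 p a := fun m hm => by
  by_contra h
  have := ha m h
  omega

theorem SupportedIn.eq_zero {p : ℕ} {a : A} (ha : SupportedIn 𝒜 p 0 a)
    (h : component 𝒜 p a = 0) : a = 0 :=
  eq_of_component_eq (𝒜 := 𝒜) fun m => by
    by_contra hm
    rw [map_zero] at hm
    have := ha m hm
    exact hm ((show m = p by omega) ▸ h)

theorem SupportedIn.succ {p l : ℕ} {a : A} (ha : SupportedIn 𝒜 p (l + 1) a)
    (h : component 𝒜 p a = 0) : SupportedIn 𝒜 (p + 1) l a := by
  intro m hm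
  have h1 := ha m hm
  have : m ≠ p := fun hmp => hm (hmp ▸ h)
  omega

theorem SupportedIn.sub_component {p l : ℕ} {a : A} (ha : SupportedIn 𝒜 p (l + 1) a) :
    SupportedIn 𝒜 (p + 1) l (a - component 𝒜 p a) := by
  refine SupportedIn.succ (fun m hm => ?_) ?_
  · rw [map_sub, component_component] at hm
    by_cases h : p = m
    · omega
    · rw [if_neg h, sub_zero] at hm
      exact ha m hm
  · rw [map_sub, component_component, if_pos rfl, sub_self]

theorem exists_supportedIn (a : A) : ∃ l, SupportedIn 𝒜 0 l a := by
  obtain ⟨N, hN⟩ := exists_component_bound 𝒜 a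
  refine ⟨N, fun m hm => ⟨m.zero_le, ?_⟩⟩
  by_contra h
  exact hm (hN m (by omega))

theorem eq_sum_component {a : A} : ∃ N, a = ∑ n ∈ Finset.range N, component 𝒜 n a := by
  obtain ⟨N, hN⟩ := exists_component_bound 𝒜 a
  exact ⟨N, (sum_component hN).symm⟩

/-- The rank condition gives the Ore condition; a homogeneous part of the resulting dependence makes
the multiplier homogeneous. -/
theorem exists_homogeneous_common_multiple [IsNoetherianRing A] [IsDomain A] {p u : A} {n e : ℕ}
    (hp : p ∈ 𝒜 n) (hu : u ∈ 𝒜 e) (hu0 : u ≠ 0) :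
    ∃ (j : ℕ) (s b : A), s ∈ 𝒜 j ∧ s ≠ 0 ∧ s * p = b * u := by
  have hdep : ¬ LinearIndependent A ![p, u] := fun h => by
    have := h.fintype_card_le_finrank
    simp at this
  obtain ⟨g, hg, i, hi⟩ := Fintype.not_linearIndependent_iff.1 hdep
  simp only [Fin.sum_univ_two, Matrix.cons_val_zero, Matrix.cons_val_one, smul_eq_mul] at hg
  have hg0 : g 0 ≠ 0 := fun h0 => by
    rw [h0, zero_mul, zero_add] at hg
    have h1 := (mul_eq_zero.1 hg).resolve_right hu0
    fin_cases i
    · exact hi h0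
    · exact hi h1
  obtain ⟨j, hj⟩ := exists_component_ne_zero (𝒜 := 𝒜) hg0
  have h1 := congrArg (component 𝒜 (j + n)) hg
  rw [map_add, component_mul_right_add hp, component_mul_right hu, map_zero] at h1
  refine ⟨j, component 𝒜 j (g 0), if e ≤ j + n then -component 𝒜 (j + n - e) (g 1) else 0,
    component_mem 𝒜 _ _, hj, ?_⟩
  rw [eq_neg_of_add_eq_zero_left h1]
  split_ifs <;> simp

end Support

/-! ### A noncommutative Gauss lemma. -/

section Gauss

variable {k : Type u} [Field k] {A : Type v} [Ring A] [Algebra k A]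
variable {𝒜 : ℕ → Submodule k A} [GradedAlgebra 𝒜]

theorem component_mem_range_mul {s a : A} {j : ℕ} (hs : s ∈ 𝒜 j) (h : ∃ t, s * t = a) (n : ℕ) :
    ∃ t, s * t = component 𝒜 n a := by
  obtain ⟨t, rfl⟩ := h
  rw [component_mul_left hs]
  split_ifs
  · exact ⟨_, rfl⟩
  · exact ⟨0, mul_zero s⟩

theorem add_mem_range_mul {s a b : A} (ha : ∃ t, s * t = a) (hb : ∃ t, s * t = b) :
    ∃ t, s * t = a + b := by
  obtain ⟨t, rfl⟩ := ha
  obtain ⟨r, rfl⟩ := hb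
  exact ⟨t + r, mul_add _ _ _⟩

theorem sub_mem_range_mul {s a b : A} (ha : ∃ t, s * t = a) (hb : ∃ t, s * t = b) :
    ∃ t, s * t = a - b := by
  obtain ⟨t, rfl⟩ := ha
  obtain ⟨r, rfl⟩ := hb
  exact ⟨t - r, mul_sub _ _ _⟩

theorem mul_mem_range_mul {s a : A} (ha : ∃ t, s * t = a) (b : A) : ∃ t, s * t = a * b := by
  obtain ⟨t, rfl⟩ := ha
  exact ⟨t * b, (mul_assoc _ _ _).symm⟩

/-- A form of Gauss's lemma: if `c` is primitive with respect to the homogeneous element `s`, and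
commutes with its components, then `a * c ∈ s A` implies `a ∈ s A`. -/
theorem exists_mul_eq_of_primitive {c : A}
    (hc : ∀ i, component 𝒜 i c * c = c * component 𝒜 i c) {s : A} {j : ℕ} (hs : s ∈ 𝒜 j)
    (hprim : ∀ a, (∀ q, ∃ t, s * t = a * component 𝒜 q c) → ∃ t, s * t = a) {L : ℕ} :
    ∀ {n : ℕ} {a : A}, SupportedIn 𝒜 n L a → (∃ t, s * t = a * c) → ∃ t, s * t = a := by
  induction L with
  | zero =>
    intro n a ha hac
    have ha' : component 𝒜 n a = a := by
      have h := ha.sub (b := component 𝒜 n a) (fun m hm => ?_)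
      · refine (sub_eq_zero.1 (h.eq_zero ?_)).symm
        rw [map_sub, component_component, if_pos rfl, sub_self]
      · rw [component_component] at hm
        by_cases h : n = m
        · omega
        · rw [if_neg h] at hm
          exact absurd rfl hm
    refine hprim a fun q => ?_
    have h := component_mem_range_mul hs hac (n + q)
    rwa [← ha', add_comm, component_mul_left (component_mem 𝒜 n a), if_pos (by omega),
      Nat.add_sub_cancel, ha'] at h
  | succ L ih =>
    intro n a ha hac
    refine hprim a fun q => ?_
    induction q using Nat.strong_induction_on with
    | _ q ihq =>
      have h1 : ∃ t, s * t = a * ∑ i ∈ Finset.range q, component 𝒜 i c := by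
        rw [Finset.mul_sum]
        exact Finset.sum_induction _ (fun a => ∃ t, s * t = a) (fun _ _ => add_mem_range_mul)
          ⟨0, mul_zero s⟩ fun i hi => ihq i (Finset.mem_range.1 hi)
      have h2 := component_mem_range_mul hs (sub_mem_range_mul hac h1) (n + q)
      -- Once the terms with `i < q` are removed, the lowest component of the product is `component
      -- n a * component q c`, so this lies in `s A`.
      rw [← mul_sub, component_add_mul ha.vanishesBelow (fun l hl => by
        rw [component_sub_sum_range, if_pos hl]), component_sub_sum_range,
        if_neg (lt_irrefl q)] at h2
      -- The support is now shorter, and commuting `c` past its component shows that multiplying by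
      -- `c` lands in `s A`, so the outer induction applies.
      have h3 : ∃ t, s * t = (a - component 𝒜 n a) * component 𝒜 q c := by
        refine ih (ha.sub_component.mul_right (component_mem 𝒜 q c)) ?_
        have h4 := sub_mem_range_mul (mul_mem_range_mul hac (component 𝒜 q c))
          (mul_mem_range_mul h2 c)
        have h5 : (a - component 𝒜 n a) * component 𝒜 q c * c =
            a * c * component 𝒜 q c - component 𝒜 n a * component 𝒜 q c * c := by
          rw [sub_mul, sub_mul, mul_assoc a, hc, ← mul_assoc]
        rwa [h5]
      have h4 := add_mem_range_mul h3 h2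
      rwa [← add_mul, sub_add_cancel] at h4

end Gauss

/-! ### Primes without nonzero homogeneous elements. -/

section MinimalLength

variable {k : Type u} [Field k] {A : Type v} [Ring A] [Algebra k A]
variable {𝒜 : ℕ → Submodule k A} [GradedAlgebra 𝒜]

/-- For the least width `l`, losing the bottom component would leave a narrower nonzero element, or
nothing if `l = 0`. So elements of this width are determined by their leading forms. -/
theorem exists_minimal_length (P : TwoSidedIdeal A) (hP : P ≠ ⊥) :
    ∃ l, (∃ f ∈ P, f ≠ 0 ∧ ∃ p, SupportedIn 𝒜 p l f) ∧
      ∀ p, ∀ g ∈ P, SupportedIn 𝒜 p l g → component 𝒜 p g = 0 → g = 0 := by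
  classical
  have hex : ∃ l, ∃ f ∈ P, f ≠ 0 ∧ ∃ p, SupportedIn 𝒜 p l f := by
    by_contra! h
    refine hP (eq_bot_iff.2 fun f hf => ?_)
    by_contra h0
    obtain ⟨l, hl⟩ := exists_supportedIn (𝒜 := 𝒜) f
    exact h l f hf h0 0 hl
  refine ⟨Nat.find hex, Nat.find_spec hex, fun p g hg hsupp h0 => ?_⟩
  by_contra hg0
  obtain ⟨l, hl⟩ : ∃ l, Nat.find hex = l + 1 := by
    refine Nat.exists_eq_succ_of_ne_zero fun hz => ?_
    rw [hz] at hsupp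
    exact hg0 (hsupp.eq_zero h0)
  rw [hl] at hsupp
  exact Nat.find_min hex (m := l) (by omega) ⟨g, hg, hg0, p + 1, hsupp.succ h0⟩

/-- The elements of minimal length in a prime ideal without homogeneous elements are the multiples
of a single one by homogeneous elements. -/
theorem IsKoszul.exists_minimal_length_generator {n : ℕ} {x y : Fin n → A}
    (hK : IsKoszul 𝒜 x y) (hconn : IsConnectedGraded 𝒜) [IsNoetherianRing A] [IsDomain A]
    {d : Fin n → ℕ} {c₀ : ℕ} (hx : ∀ i, x i ∈ 𝒜 (d i))
    (hy : ∀ i, y i ∈ 𝒜 (c₀ - d i) ∧ (d i ≤ c₀ ∨ y i = 0)) {P : TwoSidedIdeal A}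
    (hP : IsPrimeIdeal P) {i₀ : Fin n} (hi₀ : x i₀ ∉ P) {l : ℕ}
    (hl : ∃ f ∈ P, f ≠ 0 ∧ ∃ p, SupportedIn 𝒜 p l f)
    (hmin : ∀ p, ∀ g ∈ P, SupportedIn 𝒜 p l g → component 𝒜 p g = 0 → g = 0) :
    ∃ (c : A) (e : ℕ), c ∈ P ∧ SupportedIn 𝒜 e l c ∧ component 𝒜 e c ≠ 0 ∧
      (∀ a, ∃ b, b * component 𝒜 e c = component 𝒜 e c * a) ∧
      ∀ p, ∀ g ∈ P, SupportedIn 𝒜 p l g → ∃ b, b * c = g := by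
  let lead : A → ℕ → Prop := fun a m => ∃ g ∈ P, SupportedIn 𝒜 m l g ∧ component 𝒜 m g = a
  have hlead0 : ∀ m, lead 0 m := fun m => ⟨0, P.zero_mem, SupportedIn.zero _ _, map_zero _⟩
  have hleadadd : ∀ {a b m}, lead a m → lead b m → lead (a + b) m := by
    rintro _ _ m ⟨g, hg, hgs, rfl⟩ ⟨g', hg', hgs', rfl⟩
    exact ⟨g + g', P.add_mem hg hg', hgs.add hgs', map_add _ _ _⟩
  have hleadl : ∀ {a b m j}, lead a m → b ∈ 𝒜 j → lead (b * a) (j + m) := by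
    rintro _ b m j ⟨g, hg, hgs, rfl⟩ hb
    exact ⟨b * g, P.mul_mem_left _ _ hg, hgs.mul_left hb, component_mul_left_add hb m g⟩
  have hleadr : ∀ {a b m j}, lead a m → b ∈ 𝒜 j → lead (a * b) (m + j) := by
    rintro _ b m j ⟨g, hg, hgs, rfl⟩ hb
    exact ⟨g * b, P.mul_mem_right _ _ hg, hgs.mul_right hb, component_mul_right_add hb m g⟩
  have hmul : ∀ a, (∀ m, lead (component 𝒜 m a) m) → ∀ b m,
      lead (component 𝒜 m (b * a)) m ∧ lead (component 𝒜 m (a * b)) m := by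
    intro a ha b m
    refine component_induction (𝒜 := 𝒜)
      (p := fun b => lead (component 𝒜 m (b * a)) m ∧ lead (component 𝒜 m (a * b)) m) b
      (by simpa using hlead0 m)
      (fun _ _ h h' => by
        rw [add_mul, mul_add, map_add, map_add]
        exact ⟨hleadadd h.1 h'.1, hleadadd h.2 h'.2⟩) fun j => ?_
    have hj := component_mem 𝒜 j b
    rw [component_mul_left hj, component_mul_right hj]
    split_ifs with hjm
    · have h1 := hleadl (ha (m - j)) hj
      have h2 := hleadr (ha (m - j)) hj
      rw [Nat.add_sub_cancel' hjm] at h1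
      rw [Nat.sub_add_cancel hjm] at h2
      exact ⟨h1, h2⟩
    · exact ⟨hlead0 m, hlead0 m⟩
  let J : Ideal A :=
    { carrier := {a | ∀ m, lead (component 𝒜 m a) m}
      zero_mem' := fun m => by simpa using hlead0 m
      add_mem' := fun {a b} ha hb m => by
        rw [map_add]
        exact hleadadd (ha m) (hb m)
      smul_mem' := fun b a ha m => (hmul a ha b m).1 }
  have hJhom : ∀ {m a}, a ∈ 𝒜 m → lead a m → a ∈ J := fun {m a} ha hlead j => by
    rw [component_of_mem ha]
    split_ifs with h
    · exact h ▸ hlead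
    · exact hlead0 j
  have hsat : ∀ a, (∀ i, x i * a ∈ J) → a ∈ J := by
    intro a ha m
    have h1 : ∀ i, lead (x i * component 𝒜 m a) (d i + m) := fun i => by
      rw [← component_mul_left_add (hx i)]
      exact ha i _
    choose g hg hgs hga using h1
    -- The sum lies in `P`, has width at most `l`, and its leading form vanishes by the relation.
    -- Exactness then gives `g i = x i * r`, and `r ∈ P` has the required leading form because `P`
    -- is saturated.
    have h2 : ∑ i, y i * g i = 0 := by
      have hdc : ∀ i, c₀ - d i + (d i + m) = c₀ + m := fun i => by
        have := (hy i).2.resolve_right (hK.y_ne_zero i)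
        omega
      refine hmin (c₀ + m) _ ?_ ?_ ?_
      · exact Finset.sum_induction _ (fun a => a ∈ P) (fun _ _ h h' => P.add_mem h h')
          P.zero_mem fun i _ => P.mul_mem_left _ _ (hg i)
      · refine Finset.sum_induction _ (fun a => SupportedIn 𝒜 (c₀ + m) l a)
          (fun _ _ h h' => h.add h') (SupportedIn.zero _ _) fun i _ => ?_
        rw [← hdc i]
        exact (hgs i).mul_left (hy i).1
      · rw [map_sum]
        have h3 : ∀ i, component 𝒜 (c₀ + m) (y i * g i) = y i * x i * component 𝒜 m a := by
          intro i
          rw [← hdc i, component_mul_left_add (hy i).1, hga, mul_assoc]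
        rw [Finset.sum_congr rfl fun i _ => h3 i, ← Finset.sum_mul, hK.relation, zero_mul]
    obtain ⟨r, hr⟩ := hK.right_exact g h2
    have hx0 := hK.x_ne_zero i₀
    refine ⟨r, hK.mem_of_forall_generator_mem hP hi₀ fun i => hr i ▸ hg i, fun j hj => ?_, ?_⟩
    · have h3 := hgs i₀ (d i₀ + j) (by
        rw [hr, component_mul_left_add (hx i₀)]
        exact mul_ne_zero hx0 hj)
      omega
    · have h3 := hga i₀
      rw [hr, component_mul_left_add (hx i₀)] at h3
      exact mul_left_cancel₀ hx0 h3
  obtain ⟨u, e, hu, hgen⟩ := hK.exists_generator hconn J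
    (fun m a ha => hJhom (component_mem 𝒜 m a) (ha m)) hsat
  have hu0 : u ≠ 0 := by
    rintro rfl
    obtain ⟨f, hf, hf0, p, hp⟩ := hl
    obtain ⟨b, hb⟩ := (hgen _).1 (hJhom (component_mem 𝒜 p f) ⟨f, hf, hp, rfl⟩)
    exact hf0 (hmin p f hf hp (by rw [← hb, mul_zero]))
  have huJ : u ∈ J := (hgen u).2 ⟨1, one_mul _⟩
  have hulead := huJ e
  rw [component_same hu] at hulead
  obtain ⟨c, hc, hcs, hcu⟩ := hulead
  refine ⟨c, e, hc, hcs, hcu ▸ hu0, fun a => ?_, fun p g hg hgs => ?_⟩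
  · rw [hcu]
    exact (hgen _).1 fun m => (hmul u huJ a m).2
  · obtain ⟨b, hb⟩ := (hgen _).1 (hJhom (component_mem 𝒜 p g) ⟨g, hg, hgs, rfl⟩)
    have h1 := congrArg (component 𝒜 p) hb
    rw [component_component, if_pos rfl, component_mul_right hu] at h1
    split_ifs at h1 with hep
    · have hbm := component_mem 𝒜 (p - e) b
      have hpe : p - e + e = p := by omega
      refine ⟨component 𝒜 (p - e) b, sub_eq_zero.1 (hmin p _
        (P.sub_mem (P.mul_mem_left _ _ hc) hg) (SupportedIn.sub ?_ hgs) ?_)⟩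
      · have := hcs.mul_left hbm
        rwa [hpe] at this
      · have := component_mul_left_add hbm e c
        rw [hpe] at this
        rw [map_sub, this, hcu, h1, sub_self]
    · exact ⟨0, by rw [zero_mul, hmin p g hg hgs h1.symm]⟩

/-- A nonzero prime ideal without nonzero homogeneous elements is generated by a normal element. -/
theorem IsKoszul.exists_generator_of_no_homogeneous {n : ℕ} {x y : Fin n → A}
    (hK : IsKoszul 𝒜 x y) (hconn : IsConnectedGraded 𝒜) [IsNoetherianRing A] [IsDomain A]
    {d : Fin n → ℕ} {c₀ : ℕ} (hx : ∀ i, x i ∈ 𝒜 (d i))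
    (hy : ∀ i, y i ∈ 𝒜 (c₀ - d i) ∧ (d i ≤ c₀ ∨ y i = 0)) {P : TwoSidedIdeal A}
    (hP : IsPrimeIdeal P) (hP0 : P ≠ ⊥) (hhom : ∀ m, ∀ a ∈ 𝒜 m, a ∈ P → a = 0) :
    ∃ c, IsNormalElement c ∧ P = TwoSidedIdeal.span {c} := by
  obtain ⟨i₀⟩ : Nonempty (Fin n) := ⟨⟨0, by have := hK.eq_two; omega⟩⟩
  have hi₀ : x i₀ ∉ P := fun h => hK.x_ne_zero i₀ (hhom _ _ (hx i₀) h)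
  obtain ⟨l, hl, hmin⟩ := exists_minimal_length (𝒜 := 𝒜) P hP0
  obtain ⟨c, e, hc, hcs, hu0, huskew, hgen⟩ :=
    hK.exists_minimal_length_generator hconn hx hy hP hi₀ hl hmin
  set u := component 𝒜 e c with hu_def
  have hu : u ∈ 𝒜 e := component_mem 𝒜 e c
  have huskew' := exists_mul_eq_of_forall_exists_mul_eq (hK.finiteDimensional hconn hx) hu hu0
    huskew
  -- Normality of the leading form `u` lifts to `c`: the difference has width at most `l`, lies in
  -- `P` and has zero leading form. The same `b` works for every component of `c`.
  have hskew_hom : ∀ m, ∀ a ∈ 𝒜 m, ∃ b ∈ 𝒜 m, b * c = c * a := by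
    intro m a ha
    obtain ⟨b, hb⟩ := huskew a
    have hbm := component_mem 𝒜 m b
    have hbu : component 𝒜 m b * u = u * a := by
      rw [← component_mul_right_add hu, hb, add_comm, component_mul_left_add hu, component_same ha]
    refine ⟨_, hbm, sub_eq_zero.1 (hmin (m + e) _ (P.sub_mem (P.mul_mem_left _ _ hc)
      (P.mul_mem_right _ _ hc)) ((hcs.mul_left hbm).sub (add_comm m e ▸ hcs.mul_right ha)) ?_)⟩
    rw [map_sub, component_mul_left_add hbm, add_comm, component_mul_right_add ha, ← hu_def, hbu,
      sub_self]
  have hskew : ∀ a, ∃ b, (∀ i, b * component 𝒜 i c = component 𝒜 i c * a) ∧ b * c = c * a := by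
    intro a
    refine component_induction (𝒜 := 𝒜) (p := fun a => ∃ b,
      (∀ i, b * component 𝒜 i c = component 𝒜 i c * a) ∧ b * c = c * a) a ⟨0, by simp⟩
      (fun a a' ⟨b, hb⟩ ⟨b', hb'⟩ => ⟨b + b', fun i => ?_, ?_⟩) fun m => ?_
    · rw [add_mul, hb.1, hb'.1, mul_add]
    · rw [add_mul, hb.2, hb'.2, mul_add]
    · have ham := component_mem 𝒜 m a
      obtain ⟨b, hbm, hb⟩ := hskew_hom m _ ham
      refine ⟨b, fun i => ?_, hb⟩
      rw [← component_mul_left_add hbm, hb, add_comm, component_mul_right_add ham]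
  have hskew' : ∀ a, ∃ b, c * b = a * c := by
    intro a
    refine component_induction (𝒜 := 𝒜) (p := fun a => ∃ b, c * b = a * c) a ⟨0, by simp⟩
      (fun a a' ⟨b, hb⟩ ⟨b', hb'⟩ => ⟨b + b', by rw [mul_add, hb, hb', add_mul]⟩) fun m => ?_
    have ham := component_mem 𝒜 m a
    obtain ⟨b, hb⟩ := huskew' (component 𝒜 m a)
    have hbm := component_mem 𝒜 m b
    have hbu : u * component 𝒜 m b = component 𝒜 m a * u := by
      rw [← component_mul_left_add hu, hb, add_comm, component_mul_right_add hu, component_same ham]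
    refine ⟨component 𝒜 m b, sub_eq_zero.1 (hmin (e + m) _ (P.sub_mem (P.mul_mem_right _ _ hc)
      (P.mul_mem_left _ _ hc)) ((hcs.mul_right hbm).sub (add_comm m e ▸ hcs.mul_left ham)) ?_)⟩
    rw [map_sub, component_mul_right_add hbm, ← hu_def, hbu, add_comm, component_mul_left_add ham,
      ← hu_def, sub_self]
  -- The twist defined by `c` is determined by its effect on `u`, so it fixes `u`; hence `u`, and
  -- then each component, commutes with what is needed.
  have hucomm : ∀ i, component 𝒜 i c * u = u * component 𝒜 i c := by
    obtain ⟨b, hb, -⟩ := hskew u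
    have hbu : b = u := mul_right_cancel₀ hu0 (hb e)
    intro i
    rw [← hb i, hbu]
  have hcomm : ∀ i, component 𝒜 i c * c = c * component 𝒜 i c := by
    intro i
    obtain ⟨b, hb, hbc⟩ := hskew (component 𝒜 i c)
    have hbi : b = component 𝒜 i c := mul_right_cancel₀ hu0 ((hb e).trans (hucomm i).symm)
    rw [← hbc, hbi]
  have hcu : c * u = u * c := hcomm e |>.symm
  have huP : u ∉ P := fun h => hu0 (hhom _ _ hu h)
  have hprim_hom : ∀ {s : A} {j : ℕ}, s ∈ 𝒜 j → s ≠ 0 → ∀ m, ∀ a ∈ 𝒜 m,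
      (∀ q, ∃ t, s * t = a * component 𝒜 q c) → ∃ t, s * t = a := by
    intro s j hs hs0 m a ha h
    by_cases ha0 : a = 0
    · exact ⟨0, by rw [ha0, mul_zero]⟩
    obtain ⟨G, hG⟩ : ∃ G, s * G = a * c := by
      obtain ⟨N, hN⟩ := eq_sum_component (𝒜 := 𝒜) (a := c)
      rw [hN, Finset.mul_sum]
      exact Finset.sum_induction _ (fun a => ∃ t, s * t = a) (fun _ _ => add_mem_range_mul)
        ⟨0, mul_zero s⟩ fun i _ => h i
    have hcompG : ∀ i, s * component 𝒜 i G = component 𝒜 (j + i) (a * c) := fun i => by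
      rw [← hG, component_mul_left_add hs]
    have hjle : j ≤ m + e := by
      by_contra hlt
      have h1 := congrArg (component 𝒜 (m + e)) hG
      rw [component_mul_left hs, if_neg (by omega), component_mul_left_add ha] at h1
      exact mul_ne_zero ha0 hu0 h1.symm
    have hlow : s * component 𝒜 (m + e - j) G = a * u := by
      rw [hcompG, Nat.add_sub_cancel' hjle, component_mul_left_add ha]
    have hGs : SupportedIn 𝒜 (m + e - j) l G := by
      intro i hi
      have h1 := hcs.mul_left ha (j + i) (by
        rw [← hcompG]
        exact mul_ne_zero hs0 hi)
      omega
    -- Moving `r` across `c` and `u` by their common twist gives `G r u = G₀ r c ∈ P`, with `G₀` the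
    -- component of degree `m + e - j`; primeness and `u ∉ P` give `G ∈ P`. Then `G` is a multiple
    -- of `c`, and `c` cancels.
    have hGP : G ∈ P := by
      refine (hP.2 G u fun r => ?_).resolve_right huP
      have h1 : G * r * u = component 𝒜 (m + e - j) G * r * c := by
        apply mul_left_cancel₀ hs0
        obtain ⟨b, hb, hbc⟩ := hskew r
        rw [← mul_assoc, ← mul_assoc, hG, ← mul_assoc, ← mul_assoc, hlow, mul_assoc a c r, ← hbc,
          mul_assoc a u r, ← hb e, mul_assoc a, mul_assoc b, hcu, mul_assoc a, mul_assoc b]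
      rw [h1]
      exact P.mul_mem_left _ _ hc
    obtain ⟨b, hb⟩ := hgen _ G hGP hGs
    have hc0 : c ≠ 0 := by
      rintro rfl
      exact hu0 (map_zero _)
    exact ⟨b, mul_right_cancel₀ hc0 (by rw [mul_assoc, hb, hG])⟩
  have hprim : ∀ {s : A} {j : ℕ}, s ∈ 𝒜 j → s ≠ 0 → ∀ a,
      (∀ q, ∃ t, s * t = a * component 𝒜 q c) → ∃ t, s * t = a := by
    intro s j hs hs0 a h
    obtain ⟨N, hN⟩ := eq_sum_component (𝒜 := 𝒜) (a := a)
    rw [hN]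
    refine Finset.sum_induction _ (fun a => ∃ t, s * t = a) (fun _ _ => add_mem_range_mul)
      ⟨0, mul_zero s⟩ fun m _ => hprim_hom hs hs0 m _ (component_mem 𝒜 m a) fun q => ?_
    rw [← component_mul_right_add (component_mem 𝒜 q c)]
    exact component_mem_range_mul hs (h q) _
  -- Division by `c` with homogeneous denominators: multiply so that the leading form becomes a
  -- multiple of `u`, subtract a multiple of `c`, and the width drops.
  have hdiv : ∀ L, ∀ m, ∀ p ∈ P, SupportedIn 𝒜 m L p →
      ∃ (j : ℕ) (s a : A), s ∈ 𝒜 j ∧ s ≠ 0 ∧ s * p = a * c := by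
    intro L
    induction L with
    | zero =>
      intro m p hp hps
      obtain ⟨b, hb⟩ := hgen m p hp (hps.mono (Nat.zero_le l))
      exact ⟨0, 1, b, SetLike.GradedOne.one_mem, one_ne_zero, by rw [one_mul, hb]⟩
    | succ L ih =>
      intro m p hp hps
      rcases Nat.lt_or_ge l (L + 1) with hlL | hlL
      · obtain ⟨j, s, b, hs, hs0, hsb⟩ :=
          exists_homogeneous_common_multiple (component_mem 𝒜 m p) hu hu0
        let b' := if e ≤ j + m then component 𝒜 (j + m - e) b else 0
        have hb'u : b' * u = s * component 𝒜 m p := by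
          have h1 := congrArg (component 𝒜 (j + m)) hsb
          rw [component_mul_left_add hs, component_component, if_pos rfl,
            component_mul_right hu] at h1
          rw [h1]
          simp only [b']
          split_ifs
          · rfl
          · rw [zero_mul]
        have hb's : SupportedIn 𝒜 (j + m) (L + 1) (b' * c) ∧
            component 𝒜 (j + m) (b' * c) = b' * u := by
          simp only [b']
          split_ifs with hem
          · have hbm := component_mem 𝒜 (j + m - e) b
            have h1 := (hcs.mul_left hbm).mono hlL.le
            have h2 := component_mul_left_add hbm e c
            rw [Nat.sub_add_cancel hem] at h1 h2
            exact ⟨h1, h2⟩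
          · rw [zero_mul, zero_mul, map_zero]
            exact ⟨SupportedIn.zero _ _, rfl⟩
        have hq : SupportedIn 𝒜 (j + m + 1) L (s * p - b' * c) := by
          refine ((hps.mul_left hs).sub hb's.1).succ ?_
          rw [map_sub, component_mul_left_add hs, hb's.2, hb'u, sub_self]
        obtain ⟨j', s', a, hs', hs'0, ha⟩ := ih _ _
          (P.sub_mem (P.mul_mem_left _ _ hp) (P.mul_mem_left _ _ hc)) hq
        refine ⟨j' + j, s' * s, a + s' * b', SetLike.GradedMul.mul_mem hs' hs,
          mul_ne_zero hs'0 hs0, ?_⟩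
        rw [add_mul, ← ha]
        noncomm_ring
      · obtain ⟨b, hb⟩ := hgen m p hp (hps.mono hlL)
        exact ⟨0, 1, b, SetLike.GradedOne.one_mem, one_ne_zero, by rw [one_mul, hb]⟩
  have hskew_c : ∀ a, ∃ b, b * c = c * a := fun a => (hskew a).imp fun b hb => hb.2
  refine ⟨c, isNormalElement_of_forall_exists hskew_c hskew', le_antisymm (fun p hp => ?_)
    (TwoSidedIdeal.span_le.2 (by rintro _ rfl; exact hc))⟩
  rw [mem_span_singleton_of_normal hskew_c]
  obtain ⟨L, hL⟩ := exists_supportedIn (𝒜 := 𝒜) p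
  obtain ⟨j, s, a, hs, hs0, hsp⟩ := hdiv L 0 p hp hL
  obtain ⟨L', hL'⟩ := exists_supportedIn (𝒜 := 𝒜) a
  -- From `s * p = a * c`, Gauss's lemma gives `a = s * t`, hence `p = t * c`.
  obtain ⟨t, ht⟩ := exists_mul_eq_of_primitive hcomm hs (hprim hs hs0) hL' ⟨p, hsp⟩
  refine ⟨t, mul_left_cancel₀ hs0 ?_⟩
  rw [← mul_assoc, ht, hsp]

end MinimalLength

end NCRing

/-! ### The trichotomy of nonzero primes. -/

theorem proposition5p5 {k : Type u} [Field k] {A : Type v} [Ring A] [Algebra k A]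
    (𝒜 : ℕ → Submodule k A) [GradedAlgebra 𝒜]
    (hnoeth : NCRing.IsTwoSidedNoetherian A) (hreg : NCRing.IsASRegular 𝒜 2) :
    NCRing.IsNoetherianUFR A := by
  have hleft : IsNoetherianRing A := hnoeth.1
  have hright : IsNoetherianRing Aᵐᵒᵖ := hnoeth.2
  have hconn := hreg.connected
  obtain ⟨n, x, y, d, c, hK, hx, hy⟩ := NCRing.exists_isKoszul hleft hreg
  have hdom : IsDomain A := hK.isDomain hconn
  have hbot : ∀ {a : A}, a ∈ (⊥ : TwoSidedIdeal A) ↔ a = 0 := TwoSidedIdeal.mem_bot A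
  have hne : ∀ {w : A}, w ≠ 0 → TwoSidedIdeal.span {w} ≠ ⊥ := fun {w} hw h =>
    hw (hbot.1 (h ▸ TwoSidedIdeal.subset_span rfl))
  have hnormal : ∀ {w : A} {N : ℕ}, w ∈ 𝒜 N → w ≠ 0 → (∀ a, ∃ b, b * w = w * a) →
      NCRing.IsPrincipalIdeal (TwoSidedIdeal.span {w}) := fun {w N} hw hw0 h =>
    ⟨w, NCRing.isNormalElement_of_forall_exists h (NCRing.exists_mul_eq_of_forall_exists_mul_eq
      (hK.finiteDimensional hconn hx) hw hw0 h), rfl⟩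
  refine ⟨hnoeth, ⟨fun h => ?_, fun a b hab => ?_⟩, fun P hP hP0 => ?_⟩
  · exact one_ne_zero (hbot.1 (h ▸ trivial : (1 : A) ∈ (⊥ : TwoSidedIdeal A)))
  · have h1 := hbot.1 (hab 1)
    rw [mul_one] at h1
    rw [hbot, hbot]
    exact mul_eq_zero.1 h1
  by_cases hall : ∀ i, x i ∈ P
  · obtain ⟨w, N, hN, hw, hw0, hskew, hprime⟩ := hK.exists_prime_element hconn
      (hK.exists_homogeneous_normal hconn hx hy)
    refine ⟨_, hprime, hne hw0, hnormal hw hw0 hskew, TwoSidedIdeal.span_le.2 ?_⟩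
    rintro _ rfl
    have h1 := NCRing.mul_mem_of_forall_generator_mem hK (a := 1)
      (fun i => by simpa using hall i) (NCRing.component_ne hw hN.ne')
    simpa using h1
  · push Not at hall
    obtain ⟨i₀, hi₀⟩ := hall
    by_cases hhom : ∀ m, ∀ a ∈ 𝒜 m, a ∈ P → a = 0
    · obtain ⟨w, hw, hspan⟩ := hK.exists_generator_of_no_homogeneous hconn hx hy hP hP0 hhom
      exact ⟨P, hP, hP0, ⟨w, hw, hspan⟩, le_rfl⟩
    · push Not at hhom
      obtain ⟨m, g, hg, hgP, hg0⟩ := hhom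
      obtain ⟨w, N, hw, hw0, hskew, hprime, hle⟩ :=
        hK.exists_prime_element_of_homogeneous_mem hconn hx hP hi₀ hg hg0 hgP
      exact ⟨_, hprime, hne hw0, hnormal hw hw0 hskew, hle⟩
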